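/- **Conventions.** An *enhanced 2-category* $K$ is a strict 2-category (its 1-cells are called *loose*) with a wide, locally full sub-2-category of *tight* 1-cells; "maps" are loose unless said otherwise, and pullbacks are strict 2-pullbacks. A map $p:E\to B$ is a *discrete opfibration* if for all $e:X\to E$, $b:X\to B$ and $\varphi:pe\Rightarrow b$ there is a unique 2-cell $\lambda$ with source $e$ and $p\lambda=\varphi$. A *left-tight pullback* of a tight map $p:E\to B$ along a map $f:A\to B$ is a pullback whose projection to $A$ is tight and detects tightness ($h$ is tight whenever its composite with this projection is). A *plumbus* is an enhanced 2-category having a tight terminal object (a 2-terminal object $1$ such that all maps $X\to 1$ are tight) and left-tight pullbacks of all tight discrete opfibrations along all maps, and in which tight discrete opfibrations detect tightness ($e$ is tight whenever $pe$ is, for $p$ a tight discrete opfibration). A *representable plumbus* is a plumbus $K$ with a class of tight discrete opfibrations, called *small*, that is stable under left-tight pullback and under isomorphism over the base (among tight discrete opfibrations) and contains $\mathrm{id}_1$, together with a small discrete opfibration $u:\Omega_\bullet\to\Omega$, its *2-classifier*, such that for every $B$ the functor $f\mapsto f^*u$ from $K(B,\Omega)$ to the full subcategory of $K/B$ on the tight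 discrete opfibrations is fully faithful with essential image the small ones. A 2-cell $\varphi:f\Rightarrow g$ in $K(B,\Omega)$ is said to *classify* the map $f^*u\to g^*u$ over $B$ that it is sent to. A *classifying map* of a small $p:E\to B$ is a map $d:B\to\Omega$ for which there is a map $x:E\to\Omega_\bullet$ such that $(p,x)$ is a pullback of $u$ along $d$; $p$ is *perfect* if it has a tight classifying map. An *enhanced 2-monad* $(T,i,m)$ on $K$ is a strict 2-monad such that $T$ preserves tightness and the components of $i$ and $m$ are tight. $\mathrm{Alg}_{\mathrm{lx}}(T)$ is the enhanced 2-category of strict $T$-algebras with tight structure map, lax $T$-morphisms $(f,\bar f)$, with laxator $\bar f:\beta\,Tf\Rightarrow f\alpha$ satisfying the unit and multiplication laws, and $T$-2-morphisms; a lax morphism is tight when it is strict and its underlying map is tight. For a strict morphism $p:(E,\eta)\to(B,\beta)$ its *$T$-cartesianity defect* is the comparison map $\delta_p:TE\to\beta^*E$ into the pullback of $p$ along $\beta$, induced by $Tp$ and $\eta$. **Theorem.** Let $K$ be a representable plumbus with 2-classifier $u:\Omega_\bullet\to\Omega$ and let $(T,i,m)$ be an enhanced 2-monad on $K$ such that -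 (A) $Tu$ is a small discrete opfibration; - (B) $T$ preserves pullbacks of $u$ (it sends left-tight pullbacks of $u$ along arbitrary maps to pullbacks); - (C) the naturality squares of $i$ and of $m$ at $u$ are pullbacks; - (D) $Tu$ is perfect, with a tight classifying map $\omega:T\Omega\to\Omega$; - (E) $(\Omega,\omega)$ is a strict $T$-algebra. Let $\omega_\bullet:T\Omega_\bullet\to\Omega_\bullet$ be any map such that $(Tu,\omega_\bullet)$ is a pullback of $u$ along $\omega$. Then $\omega_\bullet$ is a tight strict $T$-algebra structure, so that $u:(\Omega_\bullet,\omega_\bullet)\to(\Omega,\omega)$ is a strict $T$-morphism, and: 1. $\mathrm{Alg}_{\mathrm{lx}}(T)$ is a representable plumbus with 2-classifier $u:(\Omega_\bullet,\omega_\bullet)\to(\Omega,\omega)$, where a tight discrete opfibration of $\mathrm{Alg}_{\mathrm{lx}}(T)$ is small exactly when its underlying map is small in $K$. 2. Let $p:(E,\eta)\to(B,\beta)$ be a small discrete opfibration in $\mathrm{Alg}_{\mathrm{lx}}(T)$. If $d:B\to\Omega$ and $x:E\to\Omega_\bullet$ are such that $(p,x)$ is a pullback of $u$ along $d$ in $K$,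 then there is a unique laxator $\bar d$ such that $(d,\bar d)$ is a lax $T$-morphism and, for some lax $T$-morphism structure on $x$, $(p,x)$ is a pullback of $u$ along $(d,\bar d)$ in $\mathrm{Alg}_{\mathrm{lx}}(T)$. Moreover, for every such pullback in $\mathrm{Alg}_{\mathrm{lx}}(T)$, $(Tp,\ \omega_\bullet\,Tx)$ is a pullback of $u$ along $\omega\,Td$, the pullback $\beta^*E\to TB$ of $p$ along $\beta$ (with $\beta^*E\to E\xrightarrow{x}\Omega_\bullet$) is a pullback of $u$ along $d\beta$, and with respect to these the laxator $\bar d:\omega\,Td\Rightarrow d\beta$ classifies the $T$-cartesianity defect $\delta_p:TE\to\beta^*E$. -/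

import Mathlib

open CategoryTheory Bicategory

universe w v u

namespace Plumbus

section Strictness

variable {K : Type u} [Bicategory.{w, v} K]

/-- Equality of 2-cells of a strict 2-category whose boundaries are equal, but possibly not
definitionally so: `η ≗ θ` means that `η` and `θ` have the same source and the same target and
that they are equal along these identifications. -/
def TwoCellEq {a b : K} {f g f' g' : a ⟶ b} (η : f ⟶ g) (θ : f' ⟶ g') : Prop :=
  ∃ (hf : f = f') (hg : g = g'), η = eqToHom hf ≫ θ ≫ eqToHom hg.symm

infix:50 " ≗ " => TwoCellEq

namespace TwoCellEq

variable {a b c d : K}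

theorem refl {f g : a ⟶ b} (η : f ⟶ g) : η ≗ η := ⟨rfl, rfl, by simp⟩

theorem of_eq {f g : a ⟶ b} {η θ : f ⟶ g} (h : η = θ) : η ≗ θ := h ▸ refl η

theorem symm {f g f' g' : a ⟶ b} {η : f ⟶ g} {θ : f' ⟶ g'} (h : η ≗ θ) : θ ≗ η := by
  obtain ⟨rfl, rfl, h⟩ := h
  exact ⟨rfl, rfl, by simp [h]⟩

theorem trans {f g f' g' f'' g'' : a ⟶ b} {η : f ⟶ g} {θ : f' ⟶ g'} {κ : f'' ⟶ g''}
    (h : η ≗ θ) (h' : θ ≗ κ) : η ≗ κ := by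
  obtain ⟨rfl, rfl, h⟩ := h
  obtain ⟨rfl, rfl, h'⟩ := h'
  exact ⟨rfl, rfl, by simp [h, h']⟩

theorem eq {f g : a ⟶ b} {η θ : f ⟶ g} (h : η ≗ θ) : η = θ := by
  obtain ⟨_, _, h⟩ := h
  simpa using h

theorem eqToHom_left {f f' g : a ⟶ b} (h : f = f') (η : f' ⟶ g) : eqToHom h ≫ η ≗ η := by
  subst h; exact of_eq (by simp)

theorem eqToHom_right {f g g' : a ⟶ b} (h : g = g') (η : f ⟶ g) : η ≫ eqToHom h ≗ η := by
  subst h; exact of_eq (by simp)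

theorem eqToHom_id {f f' : a ⟶ b} (h : f = f') : eqToHom h ≗ 𝟙 f := by
  subst h; exact refl _

theorem id_congr {f f' : a ⟶ b} (h : f = f') : 𝟙 f ≗ 𝟙 f' := by
  subst h; exact refl _

/-- Composites across an identification of 1-cells respect `≗`. -/
theorem comp {f g f' g' : a ⟶ b} {k h k' h' : a ⟶ b} {η : f ⟶ g} {θ : k ⟶ h} {η' : f' ⟶ g'}
    {θ' : k' ⟶ h'} (e : g = k) (e' : g' = k') (h₁ : η ≗ η') (h₂ : θ ≗ θ') :
    η ≫ eqToHom e ≫ θ ≗ η' ≫ eqToHom e' ≫ θ' := by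
  obtain ⟨rfl, rfl, rfl⟩ := h₁
  obtain ⟨rfl, rfl, rfl⟩ := h₂
  exact of_eq (by simp)

theorem src {f g f' g' : a ⟶ b} {η : f ⟶ g} {θ : f' ⟶ g'} (h : η ≗ θ) : f = f' := h.1

theorem tgt {f g f' g' : a ⟶ b} {η : f ⟶ g} {θ : f' ⟶ g'} (h : η ≗ θ) : g = g' := h.2.1

theorem compMid {f g f' g' : a ⟶ b} {k h k' h' : a ⟶ b} {η : f ⟶ g} {θ : k ⟶ h} {η' : f' ⟶ g'}
    {θ' : k' ⟶ h'} {e : g = k} (h₁ : η ≗ η') (h₂ : θ ≗ θ') :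
    η ≫ eqToHom e ≫ θ ≗ η' ≫ eqToHom (h₁.tgt.symm.trans (e.trans h₂.src)) ≫ θ' :=
  comp _ _ h₁ h₂

theorem compMid' {f g f' g' : a ⟶ b} {h k' h' : a ⟶ b} {η : f ⟶ g} {θ : g ⟶ h} {η' : f' ⟶ g'}
    {θ' : k' ⟶ h'} (h₁ : η ≗ η') (h₂ : θ ≗ θ') :
    η ≫ θ ≗ η' ≫ eqToHom (h₁.tgt.symm.trans h₂.src) ≫ θ' :=
  (of_eq (by simp)).trans (compMid (e := rfl) h₁ h₂)

theorem whiskerLeft_mid (p : a ⟶ b) {f g h k : b ⟶ c} (η : f ⟶ g) (θ : h ⟶ k) (e : g = h) :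
    p ◁ (η ≫ eqToHom e ≫ θ) ≗ p ◁ η ≫ eqToHom (congrArg (p ≫ ·) e) ≫ p ◁ θ := by
  subst e
  exact of_eq (by simp)

theorem whiskerRight_mid {f g h k : a ⟶ b} (η : f ⟶ g) (θ : h ⟶ k) (e : g = h) (p : b ⟶ c) :
    (η ≫ eqToHom e ≫ θ) ▷ p ≗ η ▷ p ≫ eqToHom (congrArg (· ≫ p) e) ≫ θ ▷ p := by
  subst e
  exact of_eq (by simp)

theorem map₂_mid {L : Type*} [Bicategory L] (T : StrictPseudofunctor K L) {f g h k : a ⟶ b}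
    (η : f ⟶ g) (θ : h ⟶ k) (e : g = h) :
    T.map₂ (η ≫ eqToHom e ≫ θ) ≗ T.map₂ η ≫ eqToHom (congrArg T.map e) ≫ T.map₂ θ := by
  subst e
  exact of_eq (by simp)

theorem exchange {f g : a ⟶ b} {h i : b ⟶ c} (η : f ⟶ g) (θ : h ⟶ i) :
    (f ◁ θ) ≫ eqToHom rfl ≫ (η ▷ i) ≗ (η ▷ h) ≫ eqToHom rfl ≫ (g ◁ θ) :=
  of_eq (by simpa using whisker_exchange η θ)

theorem comp' {f g f' g' : a ⟶ b} {h h' : a ⟶ b} {η : f ⟶ g} {θ : g ⟶ h} {η' : f' ⟶ g'}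
    {θ' : g' ⟶ h'} (h₁ : η ≗ η') (h₂ : θ ≗ θ') : η ≫ θ ≗ η' ≫ θ' := by
  simpa using comp rfl rfl h₁ h₂

theorem whiskerLeft {f f' : a ⟶ b} (e : f = f') {g h g' h' : b ⟶ c} {η : g ⟶ h} {η' : g' ⟶ h'}
    (H : η ≗ η') : f ◁ η ≗ f' ◁ η' := by
  subst e
  obtain ⟨rfl, rfl, rfl⟩ := H
  exact of_eq (by simp)

theorem whiskerRight {f f' : b ⟶ c} (e : f = f') {g h g' h' : a ⟶ b} {η : g ⟶ h} {η' : g' ⟶ h'}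
    (H : η ≗ η') : η ▷ f ≗ η' ▷ f' := by
  subst e
  obtain ⟨rfl, rfl, rfl⟩ := H
  exact of_eq (by simp)

theorem map₂ {L : Type*} [Bicategory L] (T : StrictPseudofunctor K L) {f g f' g' : a ⟶ b}
    {η : f ⟶ g} {θ : f' ⟶ g'} (h : η ≗ θ) : T.map₂ η ≗ T.map₂ θ := by
  obtain ⟨rfl, rfl, rfl⟩ := h
  exact of_eq (by simp)

variable [Strict K]

theorem assoc_left (f : a ⟶ b) (g : b ⟶ c) {h k : c ⟶ d} (η : h ⟶ k) :
    (f ≫ g) ◁ η ≗ f ◁ g ◁ η := by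
  refine ⟨Strict.assoc _ _ _, Strict.assoc _ _ _, ?_⟩
  simp [Strict.associator_eqToIso]

theorem assoc_right {h k : a ⟶ b} (η : h ⟶ k) (f : b ⟶ c) (g : c ⟶ d) :
    η ▷ (f ≫ g) ≗ η ▷ f ▷ g := by
  refine ⟨(Strict.assoc _ _ _).symm, (Strict.assoc _ _ _).symm, ?_⟩
  simp [Strict.associator_eqToIso]

theorem assoc_mid (f : a ⟶ b) {h k : b ⟶ c} (η : h ⟶ k) (g : c ⟶ d) :
    (f ◁ η) ▷ g ≗ f ◁ η ▷ g := by
  refine ⟨Strict.assoc _ _ _, Strict.assoc _ _ _, ?_⟩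
  simp [Strict.associator_eqToIso]

theorem id_left {f g : a ⟶ b} (η : f ⟶ g) : 𝟙 a ◁ η ≗ η := by
  refine ⟨Strict.id_comp _, Strict.id_comp _, ?_⟩
  simp [Strict.leftUnitor_eqToIso]

theorem id_right {f g : a ⟶ b} (η : f ⟶ g) : η ▷ 𝟙 b ≗ η := by
  refine ⟨Strict.comp_id _, Strict.comp_id _, ?_⟩
  simp [Strict.rightUnitor_eqToIso]

theorem map₂_left {L : Type*} [Bicategory L] (T : StrictPseudofunctor K L)
    (f : a ⟶ b) {g h : b ⟶ c} (η : g ⟶ h) : T.map₂ (f ◁ η) ≗ T.map f ◁ T.map₂ η := by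
  refine ⟨T.map_comp _ _, T.map_comp _ _, ?_⟩
  simp [T.mapComp_eq_eqToIso]

theorem map₂_right {L : Type*} [Bicategory L] (T : StrictPseudofunctor K L)
    {g h : a ⟶ b} (η : g ⟶ h) (f : b ⟶ c) : T.map₂ (η ▷ f) ≗ T.map₂ η ▷ T.map f := by
  refine ⟨T.map_comp _ _, T.map_comp _ _, ?_⟩
  simp [T.mapComp_eq_eqToIso]

end TwoCellEq

end Strictness

/-! ### Enhanced 2-categories -/

/-- An enhanced 2-category: a strict 2-category (whose 1-cells are the *loose* ones) together with
a wide and locally full sub-2-category, given by the class of *tight* 1-cells. -/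
class Enhanced (K : Type u) [Bicategory.{w, v} K] extends Bicategory.Strict K where
  IsTight : ∀ {a b : K}, (a ⟶ b) → Prop
  id_tight : ∀ a : K, IsTight (𝟙 a)
  comp_tight : ∀ {a b c : K} {f : a ⟶ b} {g : b ⟶ c}, IsTight f → IsTight g → IsTight (f ≫ g)

open Enhanced

section Limits

variable {K : Type u} [Bicategory.{w, v} K]

/-- `fst` and `snd` exhibit `P` as a (strict) 2-pullback of `f` and `g`. -/
structure IsTwoPullback {P A B C : K} (fst : P ⟶ A) (snd : P ⟶ B) (f : A ⟶ C) (g : B ⟶ C) :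
    Prop where
  w : fst ≫ f = snd ≫ g
  existsUnique_lift : ∀ {X : K} (x : X ⟶ A) (y : X ⟶ B), x ≫ f = y ≫ g →
    ∃! h : X ⟶ P, h ≫ fst = x ∧ h ≫ snd = y
  existsUnique_lift₂ : ∀ {X : K} (h k : X ⟶ P) (φ : h ≫ fst ⟶ k ≫ fst) (ψ : h ≫ snd ⟶ k ≫ snd),
    φ ▷ f ≗ ψ ▷ g → ∃! γ : h ⟶ k, γ ▷ fst = φ ∧ γ ▷ snd = ψ

/-- A map `p : E ⟶ B` is a discrete opfibration when every 2-cell `φ : e ≫ p ⟶ b` is the image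
of a unique 2-cell `e ⟶ e'` with source `e`. -/
def IsDiscreteOpfibration {E B : K} (p : E ⟶ B) : Prop :=
  ∀ {X : K} (e : X ⟶ E) (b : X ⟶ B) (φ : e ≫ p ⟶ b),
    ∃! l : Σ e' : X ⟶ E, (e ⟶ e'), l.2 ▷ p ≗ φ

variable [Enhanced K]

/-- A 2-terminal object such that all maps into it are tight. -/
def IsTightTerminal (t : K) : Prop :=
  ∀ X : K, ∃ f : X ⟶ t, IsTight f ∧ (∀ g : X ⟶ t, g = f) ∧ ∀ η : f ⟶ f, η = 𝟙 f

/-- A left-tight pullback: a 2-pullback of a tight map `g` along a loose map `f` whose projection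
`fst` is tight and detects tightness. -/
structure IsLeftTightPullback {P A B C : K} (fst : P ⟶ A) (snd : P ⟶ B) (f : A ⟶ C) (g : B ⟶ C) :
    Prop extends IsTwoPullback fst snd f g where
  right_tight : IsTight g
  left_tight : IsTight fst
  detects : ∀ {X : K} (h : X ⟶ P), IsTight (h ≫ fst) → IsTight h

/-- A tight discrete opfibration. -/
structure IsTightDopf {E B : K} (p : E ⟶ B) : Prop where
  tight : IsTight p
  dopf : IsDiscreteOpfibration p

end Limits

/-- A plumbus: an enhanced 2-category with a tight terminal object and all left-tight pullbacks of
tight discrete opfibrations, in which tight discrete opfibrations detect tightness (that is, the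
pullback of a tight discrete opfibration along an identity, given by the identity square, is
left-tight). -/
structure IsPlumbus (K : Type u) [Bicategory.{w, v} K] [Enhanced K] : Prop where
  exists_terminal : ∃ t : K, IsTightTerminal t
  exists_pullback : ∀ {A E B : K} (f : A ⟶ B) (p : E ⟶ B), IsTightDopf p →
    ∃ (P : K) (fst : P ⟶ A) (snd : P ⟶ E), IsLeftTightPullback fst snd f p
  detects_tight : ∀ {X E B : K} (e : X ⟶ E) (p : E ⟶ B), IsTightDopf p →
    IsTight (e ≫ p) → IsTight e

section Classifier

variable {K : Type u} [Bicategory.{w, v} K] [Strict K]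

theorem IsTwoPullback.hom_ext {P A B C : K} {fst : P ⟶ A} {snd : P ⟶ B} {f : A ⟶ C} {g : B ⟶ C}
    (H : IsTwoPullback fst snd f g) {X : K} {h k : X ⟶ P} (h₁ : h ≫ fst = k ≫ fst)
    (h₂ : h ≫ snd = k ≫ snd) : h = k :=
  (H.existsUnique_lift (k ≫ fst) (k ≫ snd)
    (by rw [Strict.assoc, Strict.assoc, H.w])).unique ⟨h₁, h₂⟩ ⟨rfl, rfl⟩

theorem IsTwoPullback.dopf {P A B C : K} {fst : P ⟶ A} {snd : P ⟶ B} {f : A ⟶ C} {g : B ⟶ C}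
    (H : IsTwoPullback fst snd f g) (hg : IsDiscreteOpfibration g) :
    IsDiscreteOpfibration fst := by
  intro X e b φ
  have hw : (e ≫ snd) ≫ g = (e ≫ fst) ≫ f := by rw [Strict.assoc, Strict.assoc, H.w]
  obtain ⟨⟨y, l⟩, hl, hu⟩ := hg (e ≫ snd) (b ≫ f) (eqToHom hw ≫ φ ▷ f)
  have hl' : l ▷ g ≗ φ ▷ f := hl.trans (TwoCellEq.eqToHom_left _ _)
  obtain ⟨k, ⟨hk₁, hk₂⟩, -⟩ := H.existsUnique_lift b y hl'.choose_spec.choose.symm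
  subst hk₁ hk₂
  obtain ⟨γ, ⟨hγ₁, hγ₂⟩, hγ⟩ := H.existsUnique_lift₂ e k φ l hl'.symm
  refine ⟨⟨k, γ⟩, TwoCellEq.of_eq hγ₁, ?_⟩
  rintro ⟨k', γ'⟩ (hk' : γ' ▷ fst ≗ φ)
  have hkf : k' ≫ fst = k ≫ fst := hk'.choose_spec.choose
  have e₁ := hu ⟨k' ≫ snd, γ' ▷ snd⟩ (by
    refine TwoCellEq.trans ?_ (TwoCellEq.eqToHom_left _ _).symm
    refine (TwoCellEq.assoc_right _ _ _).symm.trans ?_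
    refine (TwoCellEq.whiskerRight H.w.symm (TwoCellEq.refl γ')).trans ?_
    exact (TwoCellEq.assoc_right _ _ _).trans (TwoCellEq.whiskerRight rfl hk'))
  have hks : k' ≫ snd = k ≫ snd := congrArg Sigma.fst e₁
  obtain rfl := H.hom_ext hkf hks
  have e₂ : γ' ▷ snd = l := by simpa using e₁
  rw [hγ γ' ⟨hk'.eq, e₂⟩]

theorem IsDiscreteOpfibration.unique {E B : K} {p : E ⟶ B} (hp : IsDiscreteOpfibration p) {X : K}
    {e e₁ e₂ : X ⟶ E} (l₁ : e ⟶ e₁) (l₂ : e ⟶ e₂) (h : l₁ ▷ p ≗ l₂ ▷ p) : l₁ ≗ l₂ := by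
  have := (hp e (e₂ ≫ p) (l₂ ▷ p)).unique (y₁ := ⟨e₁, l₁⟩) (y₂ := ⟨e₂, l₂⟩) h (TwoCellEq.refl _)
  cases this
  exact TwoCellEq.refl _

/-- Let `p` and `q` be maps into `B` with maps `x`, `y` into `E`, such that `(p, x)` and `(q, y)`
are pullback squares of a discrete opfibration `u : E ⟶ C` along `f` and along `g`. A 2-cell
`φ : f ⟶ g` *classifies* the map `h : p ⟶ q` over `B` when the lift along `u` of `p ◁ φ` with
source `x` has target `h ≫ y`. -/
structure Classifies {E C B P Q : K} (u : E ⟶ C) (p : P ⟶ B) (x : P ⟶ E) (q : Q ⟶ B)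
    (y : Q ⟶ E) {f g : B ⟶ C} (φ : f ⟶ g) (h : P ⟶ Q) : Prop where
  w : h ≫ q = p
  exists_lift : ∃ l : x ⟶ h ≫ y, l ▷ u ≗ p ◁ φ

theorem Classifies.existsUnique {E C B P Q : K} {u : E ⟶ C} {p : P ⟶ B} {x : P ⟶ E} {q : Q ⟶ B}
    {y : Q ⟶ E} {f g : B ⟶ C} (φ : f ⟶ g) (hu : IsDiscreteOpfibration u) (hp : p ≫ f = x ≫ u)
    (hq : IsTwoPullback q y g u) : ∃! h : P ⟶ Q, Classifies u p x q y φ h := by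
  obtain ⟨⟨z, l⟩, hl, hl'⟩ := hu x (p ≫ g) (eqToHom hp.symm ≫ p ◁ φ)
  replace hl : l ▷ u ≗ p ◁ φ := hl.trans (TwoCellEq.eqToHom_left _ _)
  obtain ⟨h, ⟨h₁, h₂⟩, h₃⟩ := hq.existsUnique_lift p z hl.choose_spec.choose.symm
  subst h₂
  refine ⟨h, ⟨h₁, l, hl⟩, ?_⟩
  rintro k ⟨k₁, l', k₂⟩
  have := congrArg Sigma.fst (hl' ⟨k ≫ y, l'⟩ (k₂.trans (TwoCellEq.eqToHom_left _ _).symm))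
  exact h₃ k ⟨k₁, this⟩

theorem Classifies.id {E C B P : K} {u : E ⟶ C} {p : P ⟶ B} {x : P ⟶ E} {f : B ⟶ C}
    (hp : p ≫ f = x ≫ u) : Classifies u p x p x (𝟙 f) (𝟙 P) :=
  ⟨Strict.id_comp _, eqToHom (Strict.id_comp x).symm, by
    refine (TwoCellEq.whiskerRight rfl (TwoCellEq.eqToHom_id _)).trans ?_
    refine ⟨hp.symm, hp.symm, by simp⟩⟩

theorem Classifies.comp {E C B P Q R : K} {u : E ⟶ C} {p : P ⟶ B} {x : P ⟶ E} {q : Q ⟶ B}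
    {y : Q ⟶ E} {r : R ⟶ B} {z : R ⟶ E} {f g k : B ⟶ C} {φ : f ⟶ g} {ψ : g ⟶ k} {s : P ⟶ Q}
    {t : Q ⟶ R} (hs : Classifies u p x q y φ s) (ht : Classifies u q y r z ψ t) :
    Classifies u p x r z (φ ≫ ψ) (s ≫ t) := by
  obtain ⟨rfl, l, hl⟩ := hs
  obtain ⟨rfl, m, hm⟩ := ht
  refine ⟨Strict.assoc s t r, l ≫ s ◁ m ≫ eqToHom (Strict.assoc s t z).symm, ?_⟩
  rw [← Category.assoc l, Bicategory.whiskerLeft_comp]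
  refine (TwoCellEq.whiskerRight rfl
    (TwoCellEq.eqToHom_right (Strict.assoc s t z).symm (l ≫ s ◁ m))).trans ?_
  rw [Bicategory.comp_whiskerRight]
  refine TwoCellEq.comp' hl ?_
  refine (TwoCellEq.assoc_mid s m u).trans ?_
  exact (TwoCellEq.whiskerLeft rfl hm).trans (TwoCellEq.assoc_left _ _ _).symm

end Classifier

section Classifier

variable {K : Type u} [Bicategory.{w, v} K] [Enhanced K]

theorem IsLeftTightPullback.tightDopf {P A B C : K} {fst : P ⟶ A} {snd : P ⟶ B} {f : A ⟶ C}
    {g : B ⟶ C} (H : IsLeftTightPullback fst snd f g) (hg : IsTightDopf g) : IsTightDopf fst :=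
  ⟨H.left_tight, H.dopf hg.dopf⟩

/-- A pullback-ideal of tight discrete opfibrations: a class of tight discrete opfibrations which
is replete (closed under isomorphism over the base) and stable under left-tight pullback. -/
structure IsPullbackIdeal (Small : ∀ {E B : K}, (E ⟶ B) → Prop) : Prop where
  tightDopf : ∀ {E B : K} (p : E ⟶ B), Small p → IsTightDopf p
  replete : ∀ {E E' B : K} (p : E ⟶ B) (p' : E' ⟶ B), Small p → IsTightDopf p' →
    ∀ (h : E ⟶ E') (k : E' ⟶ E), h ≫ k = 𝟙 E → k ≫ h = 𝟙 E' → h ≫ p' = p → Small p'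
  pullback : ∀ {P A E B : K} (fst : P ⟶ A) (snd : P ⟶ E) (f : A ⟶ B) (p : E ⟶ B), Small p →
    IsLeftTightPullback fst snd f p → Small fst

/-- The tight discrete opfibrations over `B`. -/
structure TdOpfib (B : K) where
  dom : K
  hom : dom ⟶ B
  isTightDopf : IsTightDopf hom

/-- Maps over `B`: `TdOpfib B` is a full subcategory of the slice over `B`. -/
@[ext]
structure TdOpfib.Hom {B : K} (p q : TdOpfib B) where
  map : p.dom ⟶ q.dom
  w : map ≫ q.hom = p.hom

instance (B : K) : Category (TdOpfib B) where
  Hom := TdOpfib.Hom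
  id p := ⟨𝟙 _, Strict.id_comp _⟩
  comp h k := ⟨h.map ≫ k.map, by rw [Strict.assoc, k.w, h.w]⟩
  id_comp h := TdOpfib.Hom.ext (Strict.id_comp _)
  comp_id h := TdOpfib.Hom.ext (Strict.comp_id _)
  assoc h k l := TdOpfib.Hom.ext (Strict.assoc _ _ _)

namespace TdOpfib

/-- The pullback `f^* u`. -/
noncomputable def pullback (hK : IsPlumbus K) {E C B : K} (u : E ⟶ C) (hu : IsTightDopf u)
    (f : B ⟶ C) : TdOpfib B where
  dom := (hK.exists_pullback f u hu).choose
  hom := (hK.exists_pullback f u hu).choose_spec.choose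
  isTightDopf := (hK.exists_pullback f u hu).choose_spec.choose_spec.choose_spec.tightDopf hu

/-- The second projection of the pullback `f^* u`. -/
noncomputable def pullbackSnd (hK : IsPlumbus K) {E C B : K} (u : E ⟶ C) (hu : IsTightDopf u)
    (f : B ⟶ C) : (pullback hK u hu f).dom ⟶ E :=
  (hK.exists_pullback f u hu).choose_spec.choose_spec.choose

theorem isLeftTightPullback (hK : IsPlumbus K) {E C B : K} (u : E ⟶ C) (hu : IsTightDopf u)
    (f : B ⟶ C) :
    IsLeftTightPullback (pullback hK u hu f).hom (pullbackSnd hK u hu f) f u :=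
  (hK.exists_pullback f u hu).choose_spec.choose_spec.choose_spec

theorem existsUnique_pullbackMap (hK : IsPlumbus K) {E C B : K} (u : E ⟶ C) (hu : IsTightDopf u)
    {f g : B ⟶ C} (φ : f ⟶ g) :
    ∃! h, Classifies u (pullback hK u hu f).hom (pullbackSnd hK u hu f)
      (pullback hK u hu g).hom (pullbackSnd hK u hu g) φ h :=
  Classifies.existsUnique φ hu.dopf (isLeftTightPullback hK u hu f).w
    (isLeftTightPullback hK u hu g).toIsTwoPullback

/-- The functor `f ↦ f^* u` from maps `B ⟶ C` to tight discrete opfibrations over `B`; a 2-cell is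
sent to the map over `B` which it classifies. (It depends on the choice of pullbacks only up to a
canonical isomorphism, by which it is also pseudonatural in `B`.) -/
noncomputable def pullbackFunctor (hK : IsPlumbus K) {E C : K} (u : E ⟶ C) (hu : IsTightDopf u)
    (B : K) : (B ⟶ C) ⥤ TdOpfib B where
  obj f := pullback hK u hu f
  map φ := ⟨(existsUnique_pullbackMap hK u hu φ).choose,
    (existsUnique_pullbackMap hK u hu φ).choose_spec.1.w⟩
  map_id f := TdOpfib.Hom.ext
    ((existsUnique_pullbackMap hK u hu (𝟙 f)).unique
      (existsUnique_pullbackMap hK u hu (𝟙 f)).choose_spec.1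
      (Classifies.id (isLeftTightPullback hK u hu f).w))
  map_comp φ ψ := TdOpfib.Hom.ext
    ((existsUnique_pullbackMap hK u hu (φ ≫ ψ)).unique
      (existsUnique_pullbackMap hK u hu (φ ≫ ψ)).choose_spec.1
      (Classifies.comp (existsUnique_pullbackMap hK u hu φ).choose_spec.1
        (existsUnique_pullbackMap hK u hu ψ).choose_spec.1))

end TdOpfib

/-- `u` is a 2-classifier for the class `Small` of tight discrete opfibrations: `u` is small, and
for every `B` pulling back `u` is a fully faithful functor from `K(B, Ω)` to tight discrete
opfibrations over `B`, with essential image the small ones (so that it corestricts to an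
equivalence onto the full subcategory of small discrete opfibrations over `B`). -/
structure IsTwoClassifier (hK : IsPlumbus K) (Small : ∀ {E B : K}, (E ⟶ B) → Prop)
    {Ωpt Ω : K} (u : Ωpt ⟶ Ω) : Prop where
  small : Small u
  tightDopf : IsTightDopf u
  full : ∀ B : K, (TdOpfib.pullbackFunctor hK u tightDopf B).Full
  faithful : ∀ B : K, (TdOpfib.pullbackFunctor hK u tightDopf B).Faithful
  essImage_iff : ∀ {B : K} (p : TdOpfib B),
    (TdOpfib.pullbackFunctor hK u tightDopf B).essImage p ↔ Small p.hom

/-- A representable plumbus: a plumbus with a pullback-ideal `Small` of tight discrete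
opfibrations containing the identity of the terminal object, and a 2-classifier `u` for it. -/
structure IsRepresentablePlumbus (Small : ∀ {E B : K}, (E ⟶ B) → Prop) {Ωpt Ω : K}
    (u : Ωpt ⟶ Ω) : Prop where
  isPlumbus : IsPlumbus K
  isPullbackIdeal : IsPullbackIdeal Small
  small_id : ∀ t : K, IsTightTerminal t → Small (𝟙 t)
  isTwoClassifier : IsTwoClassifier isPlumbus Small u

end Classifier

/-! ### Enhanced 2-monads and their algebras -/

open Enhanced

/-- An enhanced 2-monad: a 2-functor `T` preserving tightness, with 2-natural unit `i` and
multiplication `m` having tight components and satisfying the strict monad laws. -/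
structure EnhancedTwoMonad (K : Type u) [Bicategory.{w, v} K] [Enhanced K] where
  T : StrictPseudofunctor K K
  map_tight : ∀ {A B : K} (f : A ⟶ B), IsTight f → IsTight (T.map f)
  i : ∀ A : K, A ⟶ T.obj A
  i_tight : ∀ A : K, IsTight (i A)
  i_naturality : ∀ {A B : K} (f : A ⟶ B), f ≫ i B = i A ≫ T.map f
  i_naturality₂ : ∀ {A B : K} {f g : A ⟶ B} (η : f ⟶ g), η ▷ i B ≗ i A ◁ T.map₂ η
  m : ∀ A : K, T.obj (T.obj A) ⟶ T.obj A
  m_tight : ∀ A : K, IsTight (m A)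
  m_naturality : ∀ {A B : K} (f : A ⟶ B), T.map (T.map f) ≫ m B = m A ≫ T.map f
  m_naturality₂ : ∀ {A B : K} {f g : A ⟶ B} (η : f ⟶ g),
    T.map₂ (T.map₂ η) ▷ m B ≗ m A ◁ T.map₂ η
  i_m : ∀ A : K, i (T.obj A) ≫ m A = 𝟙 (T.obj A)
  map_i_m : ∀ A : K, T.map (i A) ≫ m A = 𝟙 (T.obj A)
  assoc : ∀ A : K, T.map (m A) ≫ m A = m (T.obj A) ≫ m A

section Algebras

variable {K : Type u} [Bicategory.{w, v} K] [Enhanced K]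

/-- A strict `T`-algebra with tight structure map. -/
structure Alg (M : EnhancedTwoMonad K) where
  carrier : K
  str : M.T.obj carrier ⟶ carrier
  str_tight : IsTight str
  unit : M.i carrier ≫ str = 𝟙 carrier
  assoc : M.m carrier ≫ str = M.T.map str ≫ str

namespace Alg

variable {M : EnhancedTwoMonad K}

theorem lax_source_eq (A B : Alg M) (f : A.carrier ⟶ B.carrier) :
    M.T.map (A.str ≫ f) ≫ B.str = M.T.map A.str ≫ M.T.map f ≫ B.str := by
  rw [M.T.map_comp, Strict.assoc]

/-- A lax `T`-morphism: a map `hom` with a laxator satisfying the unit and multiplication laws. -/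
structure LaxHom (A B : Alg M) where
  hom : A.carrier ⟶ B.carrier
  laxator : M.T.map hom ≫ B.str ⟶ A.str ≫ hom
  unit : M.i A.carrier ◁ laxator ≗ 𝟙 hom
  mul : M.m A.carrier ◁ laxator ≗
    M.T.map₂ laxator ▷ B.str ≫ eqToHom (lax_source_eq A B hom) ≫ M.T.map A.str ◁ laxator

/-- A `T`-2-morphism: a 2-cell compatible with the laxators. -/
@[ext]
structure LaxHom₂ {A B : Alg M} (f g : LaxHom A B) where
  hom₂ : f.hom ⟶ g.hom
  w : M.T.map₂ hom₂ ▷ B.str ≫ g.laxator = f.laxator ≫ A.str ◁ hom₂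

theorem LaxHom.ext {A B : Alg M} {f g : LaxHom A B} (h : f.hom = g.hom)
    (h' : f.laxator ≗ g.laxator) : f = g := by
  obtain ⟨f, φ, _, _⟩ := f
  obtain ⟨g, ψ, _, _⟩ := g
  obtain rfl : f = g := h
  obtain rfl : φ = ψ := h'.eq
  rfl

instance (A B : Alg M) : Category (LaxHom A B) where
  Hom := LaxHom₂
  id f := ⟨𝟙 f.hom, by simp⟩
  comp φ ψ := ⟨φ.hom₂ ≫ ψ.hom₂, by
    rw [PrelaxFunctor.map₂_comp, Bicategory.comp_whiskerRight, Category.assoc, ψ.w,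
      ← Category.assoc, φ.w, Category.assoc, Bicategory.whiskerLeft_comp]⟩
  id_comp φ := LaxHom₂.ext (Category.id_comp _)
  comp_id φ := LaxHom₂.ext (Category.comp_id _)
  assoc φ ψ χ := LaxHom₂.ext (Category.assoc _ _ _)

/-- A map commuting strictly with the algebra structures, as a lax morphism whose laxator is an
identity. -/
def LaxHom.ofStrict {A B : Alg M} (f : A.carrier ⟶ B.carrier)
    (hf : M.T.map f ≫ B.str = A.str ≫ f) : LaxHom A B where
  hom := f
  laxator := eqToHom hf
  unit := by
    refine (TwoCellEq.whiskerLeft rfl (TwoCellEq.eqToHom_id hf)).trans ?_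
    have : M.i A.carrier ≫ M.T.map f ≫ B.str = f := by
      rw [hf, ← Strict.assoc, A.unit, Strict.id_comp]
    exact ⟨this, this, by simp⟩
  mul := by
    have h₁ := TwoCellEq.whiskerLeft (rfl : M.m A.carrier = _) (TwoCellEq.eqToHom_id hf)
    refine h₁.trans (TwoCellEq.symm ?_)
    have h₂ : M.T.map₂ (eqToHom hf) ▷ B.str = eqToHom (by rw [hf]) := by
      rw [PrelaxFunctor.map₂_eqToHom, Bicategory.eqToHom_whiskerRight]
    rw [h₂, Bicategory.whiskerLeft_eqToHom, eqToHom_trans, eqToHom_trans]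
    have : M.T.map (M.T.map f ≫ B.str) ≫ B.str = M.m A.carrier ≫ M.T.map f ≫ B.str := by
      rw [M.T.map_comp, Strict.assoc, ← B.assoc, ← Strict.assoc, M.m_naturality, Strict.assoc]
    refine (TwoCellEq.eqToHom_id _).trans ⟨this, this, by simp⟩

/-- The laxator of a composite, pasted from those of `f` and `g`. -/
def LaxHom.compLaxator {A B C : Alg M} (f : LaxHom A B) (g : LaxHom B C) :
    M.T.map (f.hom ≫ g.hom) ≫ C.str ⟶ A.str ≫ f.hom ≫ g.hom :=
  eqToHom (by rw [M.T.map_comp, Strict.assoc]) ≫ (M.T.map f.hom ◁ g.laxator) ≫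
    eqToHom (Strict.assoc _ _ _).symm ≫ (f.laxator ▷ g.hom) ≫ eqToHom (Strict.assoc _ _ _)

theorem LaxHom.compLaxator_eq {A B C : Alg M} (f : LaxHom A B) (g : LaxHom B C) :
    f.compLaxator g ≗ (M.T.map f.hom ◁ g.laxator) ≫ eqToHom (Strict.assoc _ _ _).symm ≫
      (f.laxator ▷ g.hom) := by
  refine (TwoCellEq.eqToHom_left _ _).trans ?_
  simpa using TwoCellEq.eqToHom_right (Strict.assoc A.str f.hom g.hom)
    ((M.T.map f.hom ◁ g.laxator) ≫ eqToHom (Strict.assoc _ _ _).symm ≫ (f.laxator ▷ g.hom))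


theorem LaxHom.comp_unit {A B C : Alg M} (f : LaxHom A B) (g : LaxHom B C) :
    M.i A.carrier ◁ f.compLaxator g ≗ 𝟙 (f.hom ≫ g.hom) := by
  refine (TwoCellEq.whiskerLeft rfl (f.compLaxator_eq g)).trans ?_
  rw [Bicategory.whiskerLeft_comp, Bicategory.whiskerLeft_comp, Bicategory.whiskerLeft_eqToHom]
  have h₁ : M.i A.carrier ◁ M.T.map f.hom ◁ g.laxator ≗ 𝟙 (f.hom ≫ g.hom) := by
    refine (TwoCellEq.assoc_left _ _ _).symm.trans ?_
    refine (TwoCellEq.whiskerLeft (M.i_naturality f.hom).symm (TwoCellEq.refl _)).trans ?_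
    refine (TwoCellEq.assoc_left _ _ _).trans ?_
    exact (TwoCellEq.whiskerLeft rfl g.unit).trans (TwoCellEq.of_eq (by simp))
  have h₂ : M.i A.carrier ◁ f.laxator ▷ g.hom ≗ 𝟙 (f.hom ≫ g.hom) := by
    refine (TwoCellEq.assoc_mid _ _ _).symm.trans ?_
    exact (TwoCellEq.whiskerRight rfl f.unit).trans (TwoCellEq.of_eq (by simp))
  exact (TwoCellEq.comp _ rfl h₁ h₂).trans (TwoCellEq.of_eq (by simp))

theorem LaxHom.comp_mul {A B C : Alg M} (f : LaxHom A B) (g : LaxHom B C) :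
    M.m A.carrier ◁ f.compLaxator g ≗ M.T.map₂ (f.compLaxator g) ▷ C.str ≫
      eqToHom (lax_source_eq A C (f.hom ≫ g.hom)) ≫ M.T.map A.str ◁ f.compLaxator g := by
  have hg := (TwoCellEq.assoc_left (M.m A.carrier) (M.T.map f.hom) g.laxator).symm.trans <|
    (TwoCellEq.whiskerLeft (M.m_naturality f.hom).symm (TwoCellEq.refl _)).trans <|
    (TwoCellEq.assoc_left _ _ _).trans <|
    (TwoCellEq.whiskerLeft rfl g.mul).trans <|
    (TwoCellEq.whiskerLeft_mid _ _ _ _).trans <|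
    TwoCellEq.compMid (TwoCellEq.refl _)
      ((TwoCellEq.assoc_left _ _ _).symm.trans
        (TwoCellEq.whiskerLeft (M.T.map_comp (M.T.map f.hom) B.str).symm (TwoCellEq.refl _)))
  have hf := (TwoCellEq.assoc_mid (M.m A.carrier) f.laxator g.hom).symm.trans <|
    (TwoCellEq.whiskerRight rfl f.mul).trans <|
    (TwoCellEq.whiskerRight_mid _ _ _ _).trans <|
    TwoCellEq.compMid (TwoCellEq.assoc_right _ _ _).symm (TwoCellEq.assoc_mid _ _ _)
  have hL := (TwoCellEq.whiskerLeft (rfl : M.m A.carrier = _) (f.compLaxator_eq g)).trans <|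
    (TwoCellEq.whiskerLeft_mid _ _ _ _).trans (TwoCellEq.compMid hg hf)
  have hT := (TwoCellEq.whiskerRight (rfl : C.str = _)
    ((TwoCellEq.map₂ M.T (f.compLaxator_eq g)).trans <|
      (TwoCellEq.map₂_mid M.T _ _ _).trans <|
        TwoCellEq.compMid (TwoCellEq.map₂_left M.T _ _) (TwoCellEq.map₂_right M.T _ _))).trans <|
    (TwoCellEq.whiskerRight_mid _ _ _ _).trans <|
    TwoCellEq.compMid (TwoCellEq.assoc_mid _ _ _) (TwoCellEq.assoc_right _ _ _).symm
  have hA := (TwoCellEq.whiskerLeft (rfl : M.T.map A.str = _) (f.compLaxator_eq g)).trans <|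
    (TwoCellEq.whiskerLeft_mid _ _ _ _).trans <|
    TwoCellEq.compMid
      ((TwoCellEq.assoc_left _ _ _).symm.trans
        (TwoCellEq.whiskerLeft (M.T.map_comp A.str f.hom).symm (TwoCellEq.refl _)))
      (TwoCellEq.refl _)
  have hR := TwoCellEq.compMid (e := lax_source_eq A C (f.hom ≫ g.hom)) hT hA
  refine hL.trans (TwoCellEq.trans ?_ hR.symm)
  simp only [Category.assoc]
  refine TwoCellEq.compMid (TwoCellEq.refl _) ?_
  have hx := TwoCellEq.exchange (M.T.map₂ f.laxator) g.laxator
  have := TwoCellEq.compMid (e := by rw [← Strict.assoc, lax_source_eq, Strict.assoc, Strict.assoc])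
    hx (TwoCellEq.refl (M.T.map A.str ◁ f.laxator ▷ g.hom))
  simp only [Category.assoc] at this
  exact this

/-- The identity lax morphism. -/
def LaxHom.id (A : Alg M) : LaxHom A A :=
  LaxHom.ofStrict (𝟙 A.carrier) (by rw [M.T.map_id, Strict.id_comp, Strict.comp_id])

/-- The composite of lax morphisms. -/
def LaxHom.comp {A B C : Alg M} (f : LaxHom A B) (g : LaxHom B C) : LaxHom A C where
  hom := f.hom ≫ g.hom
  laxator := f.compLaxator g
  unit := f.comp_unit g
  mul := f.comp_mul g

theorem LaxHom.id_laxator (A : Alg M) : (LaxHom.id A).laxator ≗ 𝟙 A.str := by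
  have e : M.T.map (𝟙 A.carrier) ≫ A.str = A.str := by rw [M.T.map_id, Strict.id_comp]
  exact ⟨e, Strict.comp_id _, by simp [LaxHom.id, LaxHom.ofStrict]⟩

theorem LaxHom.id_comp {A B : Alg M} (f : LaxHom A B) : (LaxHom.id A).comp f = f := by
  refine LaxHom.ext (Strict.id_comp _) ?_
  refine (LaxHom.compLaxator_eq _ _).trans ?_
  have h₁ := (TwoCellEq.whiskerLeft (M.T.map_id A.carrier) (TwoCellEq.refl f.laxator)).trans
    (TwoCellEq.id_left _)
  have h₂ := (TwoCellEq.whiskerRight (rfl : f.hom = _) (LaxHom.id_laxator A)).trans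
    (TwoCellEq.of_eq (Bicategory.id_whiskerRight _ _))
  exact (TwoCellEq.compMid h₁ h₂).trans (TwoCellEq.of_eq (by simp))

theorem LaxHom.comp_id {A B : Alg M} (f : LaxHom A B) : f.comp (LaxHom.id B) = f := by
  refine LaxHom.ext (Strict.comp_id _) ?_
  refine (LaxHom.compLaxator_eq _ _).trans ?_
  have h₁ := (TwoCellEq.whiskerLeft (rfl : M.T.map f.hom = _) (LaxHom.id_laxator B)).trans
    (TwoCellEq.of_eq (Bicategory.whiskerLeft_id _ _))
  exact (TwoCellEq.compMid h₁ (TwoCellEq.id_right f.laxator)).trans (TwoCellEq.of_eq (by simp))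

theorem LaxHom.comp_assoc {A B C D : Alg M} (f : LaxHom A B) (g : LaxHom B C) (h : LaxHom C D) :
    (f.comp g).comp h = f.comp (g.comp h) := by
  refine LaxHom.ext (Strict.assoc _ _ _) ?_
  have h₁ := (LaxHom.compLaxator_eq (f.comp g) h).trans <|
    TwoCellEq.compMid
      ((TwoCellEq.whiskerLeft (M.T.map_comp f.hom g.hom) (TwoCellEq.refl h.laxator)).trans
        (TwoCellEq.assoc_left _ _ _))
      ((TwoCellEq.whiskerRight (rfl : h.hom = _) (LaxHom.compLaxator_eq f g)).trans <|
        (TwoCellEq.whiskerRight_mid _ _ _ _).trans <|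
        TwoCellEq.compMid (TwoCellEq.assoc_mid _ _ _) (TwoCellEq.assoc_right _ _ _).symm)
  have h₂ := (LaxHom.compLaxator_eq f (g.comp h)).trans <|
    TwoCellEq.compMid
      ((TwoCellEq.whiskerLeft (rfl : M.T.map f.hom = _) (LaxHom.compLaxator_eq g h)).trans
        (TwoCellEq.whiskerLeft_mid _ _ _ _))
      (TwoCellEq.refl _)
  refine h₁.trans (TwoCellEq.trans (TwoCellEq.of_eq ?_) h₂.symm)
  simp only [Category.assoc]
  rfl

theorem hom₂_w_of_eq {A B : Alg M} {f g : LaxHom A B} (h : f = g) {φ : f.hom ⟶ g.hom}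
    (hφ : φ = eqToHom (congrArg LaxHom.hom h)) :
    M.T.map₂ φ ▷ B.str ≫ g.laxator = f.laxator ≫ A.str ◁ φ := by
  subst h hφ
  simp

instance : CategoryStruct (Alg M) where
  Hom := LaxHom
  id := LaxHom.id
  comp := LaxHom.comp

/-- Left whiskering of a `T`-2-morphism. -/
def LaxHom₂.whiskerLeft {A B C : Alg M} (f : LaxHom A B) {g h : LaxHom B C} (η : LaxHom₂ g h) :
    LaxHom₂ (f.comp g) (f.comp h) where
  hom₂ := f.hom ◁ η.hom₂
  w := by
    apply TwoCellEq.eq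
    have hL := TwoCellEq.compMid' ((TwoCellEq.whiskerRight (rfl : C.str = _)
      (TwoCellEq.map₂_left M.T f.hom η.hom₂)).trans (TwoCellEq.assoc_mid _ _ _))
      (f.compLaxator_eq h)
    have hR := TwoCellEq.compMid' (f.compLaxator_eq g)
      (TwoCellEq.assoc_left A.str f.hom η.hom₂).symm
    refine hL.trans (TwoCellEq.trans ?_ hR.symm)
    have hx := TwoCellEq.compMid (e := (Strict.assoc _ _ _).symm)
      (TwoCellEq.refl (M.T.map f.hom ◁ g.laxator)) (TwoCellEq.exchange f.laxator η.hom₂)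
    have hy := TwoCellEq.compMid (e := (Strict.assoc _ _ _).symm)
      (TwoCellEq.of_eq (congrArg (M.T.map f.hom ◁ ·) η.w)) (TwoCellEq.refl (f.laxator ▷ h.hom))
    have hz := TwoCellEq.compMid (e := (Strict.assoc _ _ _).symm)
      (TwoCellEq.compMid' (TwoCellEq.refl (M.T.map f.hom ◁ g.laxator))
        (TwoCellEq.assoc_left (M.T.map f.hom) B.str η.hom₂).symm)
      (TwoCellEq.refl (f.laxator ▷ h.hom))
    simp only [Bicategory.whiskerLeft_comp, Category.assoc, eqToHom_refl, Category.id_comp]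
      at hx hy hz ⊢
    exact hy.trans (hz.trans hx)

/-- Right whiskering of a `T`-2-morphism. -/
def LaxHom₂.whiskerRight {A B C : Alg M} {f g : LaxHom A B} (η : LaxHom₂ f g) (h : LaxHom B C) :
    LaxHom₂ (f.comp h) (g.comp h) where
  hom₂ := η.hom₂ ▷ h.hom
  w := by
    apply TwoCellEq.eq
    have hL := TwoCellEq.compMid' ((TwoCellEq.whiskerRight (rfl : C.str = _)
      (TwoCellEq.map₂_right M.T η.hom₂ h.hom)).trans (TwoCellEq.assoc_right _ _ _).symm)
      (g.compLaxator_eq h)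
    have hR := TwoCellEq.compMid' (f.compLaxator_eq h)
      (TwoCellEq.assoc_mid A.str η.hom₂ h.hom).symm
    refine hL.trans (TwoCellEq.trans ?_ hR.symm)
    have hx := TwoCellEq.compMid (e := (Strict.assoc _ _ _).symm)
      (TwoCellEq.exchange (M.T.map₂ η.hom₂) h.laxator).symm (TwoCellEq.refl (g.laxator ▷ h.hom))
    have hy := TwoCellEq.compMid (e := rfl)
      (TwoCellEq.refl (M.T.map f.hom ◁ h.laxator))
      (TwoCellEq.compMid (e := (Strict.assoc _ _ _).symm)
        (TwoCellEq.assoc_right (M.T.map₂ η.hom₂) B.str h.hom)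
        (TwoCellEq.refl (g.laxator ▷ h.hom)))
    have hz := TwoCellEq.compMid (e := (Strict.assoc _ _ _).symm)
      (TwoCellEq.refl (M.T.map f.hom ◁ h.laxator))
      (TwoCellEq.of_eq (congrArg (· ▷ h.hom) η.w))
    simp only [Bicategory.comp_whiskerRight, Category.assoc, eqToHom_refl, Category.id_comp]
      at hx hy hz ⊢
    exact hx.trans (hy.trans hz)

/-- The associator, carried by that of `K`. -/
def LaxHom.associator {A B C D : Alg M} (f : LaxHom A B) (g : LaxHom B C) (h : LaxHom C D) :
    (f.comp g).comp h ≅ f.comp (g.comp h) where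
  hom := ⟨(α_ f.hom g.hom h.hom).hom,
    hom₂_w_of_eq (f.comp_assoc g h) (by rw [Strict.associator_eqToIso]; rfl)⟩
  inv := ⟨(α_ f.hom g.hom h.hom).inv,
    hom₂_w_of_eq (f.comp_assoc g h).symm (by rw [Strict.associator_eqToIso]; rfl)⟩
  hom_inv_id := LaxHom₂.ext (Iso.hom_inv_id _)
  inv_hom_id := LaxHom₂.ext (Iso.inv_hom_id _)

/-- The left unitor, carried by that of `K`. -/
def LaxHom.leftUnitor {A B : Alg M} (f : LaxHom A B) : (LaxHom.id A).comp f ≅ f where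
  hom := ⟨(λ_ f.hom).hom, hom₂_w_of_eq f.id_comp (by rw [Strict.leftUnitor_eqToIso]; rfl)⟩
  inv := ⟨(λ_ f.hom).inv, hom₂_w_of_eq f.id_comp.symm (by rw [Strict.leftUnitor_eqToIso]; rfl)⟩
  hom_inv_id := LaxHom₂.ext (Iso.hom_inv_id _)
  inv_hom_id := LaxHom₂.ext (Iso.inv_hom_id _)

/-- The right unitor, carried by that of `K`. -/
def LaxHom.rightUnitor {A B : Alg M} (f : LaxHom A B) : f.comp (LaxHom.id B) ≅ f where
  hom := ⟨(ρ_ f.hom).hom, hom₂_w_of_eq f.comp_id (by rw [Strict.rightUnitor_eqToIso]; rfl)⟩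
  inv := ⟨(ρ_ f.hom).inv, hom₂_w_of_eq f.comp_id.symm (by rw [Strict.rightUnitor_eqToIso]; rfl)⟩
  hom_inv_id := LaxHom₂.ext (Iso.hom_inv_id _)
  inv_hom_id := LaxHom₂.ext (Iso.inv_hom_id _)

/-- The bicategory of strict algebras, lax morphisms and `T`-2-morphisms: all operations on
2-cells are those of `K`. -/
instance : Bicategory (Alg M) where
  homCategory A B := inferInstanceAs (Category (LaxHom A B))
  whiskerLeft f _ _ η := LaxHom₂.whiskerLeft f η
  whiskerRight η h := LaxHom₂.whiskerRight η h
  associator := LaxHom.associator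
  leftUnitor := LaxHom.leftUnitor
  rightUnitor := LaxHom.rightUnitor
  whiskerLeft_id _ _ := LaxHom₂.ext (Bicategory.whiskerLeft_id _ _)
  whiskerLeft_comp _ _ _ _ _ _ := LaxHom₂.ext (Bicategory.whiskerLeft_comp _ _ _)
  id_whiskerLeft _ := LaxHom₂.ext (Bicategory.id_whiskerLeft _)
  comp_whiskerLeft _ _ _ _ _ := LaxHom₂.ext (Bicategory.comp_whiskerLeft _ _ _)
  id_whiskerRight _ _ := LaxHom₂.ext (Bicategory.id_whiskerRight _ _)
  comp_whiskerRight _ _ _ := LaxHom₂.ext (Bicategory.comp_whiskerRight _ _ _)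
  whiskerRight_id _ := LaxHom₂.ext (Bicategory.whiskerRight_id _)
  whiskerRight_comp _ _ _ := LaxHom₂.ext (Bicategory.whiskerRight_comp _ _ _)
  whisker_assoc _ _ _ _ _ := LaxHom₂.ext (Bicategory.whisker_assoc _ _ _)
  whisker_exchange _ _ := LaxHom₂.ext (Bicategory.whisker_exchange _ _)
  pentagon _ _ _ _ := LaxHom₂.ext (Bicategory.pentagon _ _ _ _)
  triangle _ _ := LaxHom₂.ext (Bicategory.triangle _ _)

theorem hom₂_eqToHom {A B : Alg M} {f g : LaxHom A B} (h : f = g) :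
    (eqToHom h : f ⟶ g).hom₂ = eqToHom (congrArg LaxHom.hom h) := by
  subst h; rfl

instance : Bicategory.Strict (Alg M) where
  id_comp := LaxHom.id_comp
  comp_id := LaxHom.comp_id
  assoc := LaxHom.comp_assoc
  leftUnitor_eqToIso f := Iso.ext (LaxHom₂.ext
    ((congrArg Iso.hom (Strict.leftUnitor_eqToIso (LaxHom.hom f))).trans
      (hom₂_eqToHom (LaxHom.id_comp f)).symm))
  rightUnitor_eqToIso f := Iso.ext (LaxHom₂.ext
    ((congrArg Iso.hom (Strict.rightUnitor_eqToIso (LaxHom.hom f))).trans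
      (hom₂_eqToHom (LaxHom.comp_id f)).symm))
  associator_eqToIso f g h := Iso.ext (LaxHom₂.ext
    ((congrArg Iso.hom (Strict.associator_eqToIso (LaxHom.hom f) (LaxHom.hom g)
      (LaxHom.hom h))).trans (hom₂_eqToHom (LaxHom.comp_assoc f g h)).symm))

/-- A lax morphism is strict when its laxator is an identity. -/
def LaxHom.IsStrict {A B : Alg M} (f : LaxHom A B) : Prop :=
  f.laxator ≗ 𝟙 (A.str ≫ f.hom)

theorem LaxHom.isStrict_comp {A B C : Alg M} {f : LaxHom A B} {g : LaxHom B C} (hf : f.IsStrict)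
    (hg : g.IsStrict) : (f.comp g).IsStrict := by
  refine (LaxHom.compLaxator_eq f g).trans ?_
  have h₁ := (TwoCellEq.whiskerLeft (rfl : M.T.map f.hom = _) hg).trans
    (TwoCellEq.of_eq (Bicategory.whiskerLeft_id _ _))
  have h₂ := (TwoCellEq.whiskerRight (rfl : g.hom = _) hf).trans
    (TwoCellEq.of_eq (Bicategory.id_whiskerRight _ _))
  refine (TwoCellEq.compMid h₁ h₂).trans ?_
  rw [Category.id_comp]
  exact (TwoCellEq.eqToHom_left _ _).trans
    ⟨Strict.assoc _ _ _, Strict.assoc _ _ _, by simp [LaxHom.comp]⟩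

/-- The enhanced 2-category `Alg_lx(T)`: a lax morphism is tight when it is strict and its
underlying map is tight. -/
instance : Enhanced (Alg M) where
  IsTight f := LaxHom.IsStrict f ∧ IsTight (LaxHom.hom f)
  id_tight A := ⟨(LaxHom.id_laxator A).trans (TwoCellEq.id_congr (Strict.comp_id _).symm),
    id_tight A.carrier⟩
  comp_tight hf hg := ⟨LaxHom.isStrict_comp hf.1 hg.1, comp_tight hf.2 hg.2⟩

/-- The class of tight discrete opfibrations of `Alg_lx(T)` whose underlying map is small. -/
def Small (S : ∀ {E B : K}, (E ⟶ B) → Prop) {E B : Alg M} (p : E ⟶ B) : Prop :=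
  IsTightDopf p ∧ S (LaxHom.hom p)

/-- Let `p : E ⟶ B` be a morphism of algebras and let `P`, with projections `fst` and `snd`, be a
pullback of the underlying map of `p` along the structure map of `B`. The map `δ` is the
`T`-cartesianity defect of `p`: the comparison map `TE ⟶ P` induced by `Tp` and by the structure
map of `E`. -/
structure IsCartesianityDefect {E B : Alg M} (p : LaxHom E B) {P : K}
    (fst : P ⟶ M.T.obj B.carrier) (snd : P ⟶ E.carrier) (δ : M.T.obj E.carrier ⟶ P) : Prop where
  isTwoPullback : IsTwoPullback fst snd B.str p.hom
  fst_eq : δ ≫ fst = M.T.map p.hom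
  snd_eq : δ ≫ snd = E.str

end Alg

end Algebras

end Plumbus

open Plumbus Plumbus.Enhanced

/-! A 2-cell out of a classifying map is determined by where it sends the chosen pullback square:
this genericity is what full faithfulness of pulling back `u` amounts to. Applying `T` to a pullback
`(p, x)` of `u` along `d` and pasting with `(Tu, ω_•)` gives a pullback of `u` again, so 2-cells out
of `ω ∘ Td` are determined in the same way. If `p` is a strict morphism from `(E, η)` to `(B, β)`,
then `d` has exactly one candidate laxator, the 2-cell `ω ∘ Td ⇒ d ∘ β` that sends `ω_• ∘ Tx` to
`x ∘ η`; its unit and multiplication laws, and the compatibility of a 2-cell with laxators, hold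
because both sides send a generic square to the same square.

The laws for `ω_•` are equalities between maps into `Ω_•` over the same map into `Ω`. Such maps
differ by an endomorphism of a classifying map, and naturality with respect to the tautological
point of `Ω_•` shows that this endomorphism fixes points.

Lax structures lift uniquely along strict discrete opfibrations, so pullbacks of algebras along
these are computed in `K`. That a discrete opfibration of algebras has an underlying discrete
opfibration is seen by probing it with free algebras. -/

namespace Plumbus

section Bicategory

variable {K : Type u} [Bicategory.{w, v} K]

namespace TwoCellEq

variable {a b : K}

theorem sigma_eq {f g h : a ⟶ b} {η : f ⟶ g} {θ : f ⟶ h} (H : η ≗ θ) :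
    (⟨g, η⟩ : Σ k : a ⟶ b, (f ⟶ k)) = ⟨h, θ⟩ := by
  obtain ⟨_, rfl, rfl⟩ := H
  simp

theorem exists_of_eq {f g f' g' : a ⟶ b} (hf : f = f') (hg : g = g') (η : f ⟶ g) :
    ∃ θ : f' ⟶ g', θ ≗ η := by
  subst hf hg
  exact ⟨η, refl η⟩

theorem id_comp_mid {f f' g h : a ⟶ b} {η : f ⟶ f'} (H : η ≗ 𝟙 f) (e : f' = g) (θ : g ⟶ h) :
    η ≫ eqToHom e ≫ θ ≗ θ := by
  subst e
  obtain ⟨_, rfl, rfl⟩ := H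
  exact of_eq (by simp)

theorem comp_id_mid {f g h k : a ⟶ b} (η : f ⟶ g) (e : g = h) {θ : h ⟶ k} (H : θ ≗ 𝟙 h) :
    η ≫ eqToHom e ≫ θ ≗ η := by
  subst e
  obtain ⟨_, rfl, rfl⟩ := H
  exact of_eq (by simp)

end TwoCellEq

namespace IsDiscreteOpfibration

variable {E B X : K} {p : E ⟶ B}

theorem exists_lift (hp : IsDiscreteOpfibration p) (e : X ⟶ E) {a b : X ⟶ B} (φ : a ⟶ b)
    (h : e ≫ p = a) : ∃ (e' : X ⟶ E) (l : e ⟶ e'), l ▷ p ≗ φ := by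
  subst h
  obtain ⟨⟨e', l⟩, hl, -⟩ := hp e b φ
  exact ⟨e', l, hl⟩

theorem of_exists_of_unique
    (exists_lift : ∀ {X : K} (e : X ⟶ E) (b : X ⟶ B) (φ : e ≫ p ⟶ b),
      ∃ (e' : X ⟶ E) (l : e ⟶ e'), l ▷ p ≗ φ)
    (unique : ∀ {X : K} {e e₁ e₂ : X ⟶ E} (l₁ : e ⟶ e₁) (l₂ : e ⟶ e₂),
      l₁ ▷ p ≗ l₂ ▷ p → l₁ ≗ l₂) :
    IsDiscreteOpfibration p := by
  intro X e b φ
  obtain ⟨e', l, hl⟩ := exists_lift e b φ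
  exact ⟨⟨e', l⟩, hl, fun l' hl' => (unique l'.2 l (hl'.trans hl.symm)).sigma_eq⟩

variable [Strict K]

theorem unique_of_eq (hp : IsDiscreteOpfibration p) {e e' e₁ e₂ : X ⟶ E} (h : e = e')
    {l₁ : e ⟶ e₁} {l₂ : e' ⟶ e₂} (H : l₁ ▷ p ≗ l₂ ▷ p) : l₁ ≗ l₂ := by
  subst h
  exact hp.unique l₁ l₂ H

theorem eq_id (hp : IsDiscreteOpfibration p) {e e' : X ⟶ E} {b : X ⟶ B} {l : e ⟶ e'}
    (H : l ▷ p ≗ 𝟙 b) : l ≗ 𝟙 e := by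
  refine hp.unique l (𝟙 e) (H.trans ?_)
  rw [Bicategory.id_whiskerRight]
  exact TwoCellEq.id_congr H.src.symm

theorem id (B : K) : IsDiscreteOpfibration (𝟙 B) := by
  refine of_exists_of_unique (fun e b φ => ?_) (fun l₁ l₂ h => ?_)
  · obtain ⟨l, hl⟩ := TwoCellEq.exists_of_eq (Strict.comp_id e) rfl φ
    exact ⟨b, l, (TwoCellEq.id_right l).trans hl⟩
  · exact (TwoCellEq.id_right l₁).symm.trans (h.trans (TwoCellEq.id_right l₂))

end IsDiscreteOpfibration

end Bicategory

section Terminal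

variable {K : Type u} [Bicategory.{w, v} K] [Enhanced K] {t : K} (ht : IsTightTerminal t) {X : K}
include ht

theorem IsTightTerminal.hom_ext (f g : X ⟶ t) : f = g := by
  obtain ⟨h, -, hom_eq, -⟩ := ht X
  rw [hom_eq f, hom_eq g]

theorem IsTightTerminal.twoCellEq {f g f' g' : X ⟶ t} (η : f ⟶ g) (θ : f' ⟶ g') : η ≗ θ := by
  obtain ⟨h, -, hom_eq, hom₂_eq⟩ := ht X
  obtain rfl := hom_eq f
  obtain rfl := hom_eq g
  obtain rfl := hom_eq f'
  obtain rfl := hom_eq g'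
  rw [hom₂_eq η, hom₂_eq θ]
  exact .refl _

end Terminal

/-! ### Strict 2-pullbacks -/

namespace IsTwoPullback

variable {K : Type u} [Bicategory.{w, v} K] {P A B C X : K} {fst : P ⟶ A} {snd : P ⟶ B}
  {f : A ⟶ C} {g : B ⟶ C}

theorem flip (H : IsTwoPullback fst snd f g) : IsTwoPullback snd fst g f where
  w := H.w.symm
  existsUnique_lift x y h := by simpa only [and_comm] using H.existsUnique_lift y x h.symm
  existsUnique_lift₂ h k φ ψ e := by
    simpa only [and_comm] using H.existsUnique_lift₂ h k ψ φ e.symm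

theorem exists_lift (H : IsTwoPullback fst snd f g) (x : X ⟶ A) (y : X ⟶ B) (h : x ≫ f = y ≫ g) :
    ∃ l : X ⟶ P, l ≫ fst = x ∧ l ≫ snd = y :=
  (H.existsUnique_lift x y h).exists

theorem exists_lift₂ (H : IsTwoPullback fst snd f g) {h k : X ⟶ P} {a a' : X ⟶ A} {b b' : X ⟶ B}
    (φ : a ⟶ a') (ψ : b ⟶ b') (ha : h ≫ fst = a) (ha' : k ≫ fst = a') (hb : h ≫ snd = b)
    (hb' : k ≫ snd = b') (w : φ ▷ f ≗ ψ ▷ g) : ∃ γ : h ⟶ k, γ ▷ fst ≗ φ ∧ γ ▷ snd ≗ ψ := by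
  subst ha ha' hb hb'
  obtain ⟨γ, ⟨h₁, h₂⟩, -⟩ := H.existsUnique_lift₂ h k φ ψ w
  exact ⟨γ, .of_eq h₁, .of_eq h₂⟩

theorem of_exists_of_ext (w : fst ≫ f = snd ≫ g)
    (exists_lift : ∀ {X : K} (x : X ⟶ A) (y : X ⟶ B), x ≫ f = y ≫ g →
      ∃ l : X ⟶ P, l ≫ fst = x ∧ l ≫ snd = y)
    (hom_ext : ∀ {X : K} {h k : X ⟶ P}, h ≫ fst = k ≫ fst → h ≫ snd = k ≫ snd → h = k)
    (exists_lift₂ : ∀ {X : K} (h k : X ⟶ P) (φ : h ≫ fst ⟶ k ≫ fst) (ψ : h ≫ snd ⟶ k ≫ snd),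
      φ ▷ f ≗ ψ ▷ g → ∃ γ : h ⟶ k, γ ▷ fst ≗ φ ∧ γ ▷ snd ≗ ψ)
    (hom₂_ext : ∀ {X : K} {h k : X ⟶ P} {γ γ' : h ⟶ k}, γ ▷ fst ≗ γ' ▷ fst →
      γ ▷ snd ≗ γ' ▷ snd → γ = γ') : IsTwoPullback fst snd f g where
  w := w
  existsUnique_lift x y h := by
    obtain ⟨l, rfl, rfl⟩ := exists_lift x y h
    exact ⟨l, ⟨rfl, rfl⟩, fun k hk => hom_ext hk.1 hk.2⟩
  existsUnique_lift₂ h k φ ψ e := by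
    obtain ⟨γ, hγ, hη⟩ := exists_lift₂ h k φ ψ e
    exact ⟨γ, ⟨hγ.eq, hη.eq⟩, fun δ hδ =>
      hom₂_ext ((TwoCellEq.of_eq hδ.1).trans hγ.symm) ((TwoCellEq.of_eq hδ.2).trans hη.symm)⟩

variable [Strict K]

theorem whiskerRight_w (H : IsTwoPullback fst snd f g) {h k : X ⟶ P} (γ : h ⟶ k) :
    γ ▷ fst ▷ f ≗ γ ▷ snd ▷ g :=
  (TwoCellEq.assoc_right _ _ _).symm.trans
    ((TwoCellEq.whiskerRight H.w (.refl _)).trans (TwoCellEq.assoc_right _ _ _))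

theorem hom₂_ext (H : IsTwoPullback fst snd f g) {h k : X ⟶ P} {γ γ' : h ⟶ k}
    (h₁ : γ ▷ fst ≗ γ' ▷ fst) (h₂ : γ ▷ snd ≗ γ' ▷ snd) : γ = γ' :=
  (H.existsUnique_lift₂ h k (γ' ▷ fst) (γ' ▷ snd) (H.whiskerRight_w γ')).unique
    ⟨h₁.eq, h₂.eq⟩ ⟨rfl, rfl⟩

theorem paste (H : IsTwoPullback fst snd f g) {D E : K} {y : B ⟶ D} {h : C ⟶ E} {k : D ⟶ E}
    (H' : IsTwoPullback g y h k) : IsTwoPullback fst (snd ≫ y) (f ≫ h) k := by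
  refine of_exists_of_ext ?_ (fun a d e => ?_) (fun e e' => ?_) (fun a b φ ψ e => ?_)
    (fun {X a b γ γ'} e e' => ?_)
  · rw [← Strict.assoc, H.w, Strict.assoc, H'.w, Strict.assoc]
  · obtain ⟨b, hb, rfl⟩ := H'.exists_lift (a ≫ f) d (by rw [Strict.assoc, e])
    obtain ⟨l, rfl, rfl⟩ := H.exists_lift a b hb.symm
    exact ⟨l, rfl, (Strict.assoc _ _ _).symm⟩
  · refine H.hom_ext e (H'.hom_ext ?_ ?_)
    · rw [Strict.assoc, Strict.assoc, ← H.w, ← Strict.assoc, e, Strict.assoc]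
    · rw [Strict.assoc, Strict.assoc, e']
  · have w' {X : K} (c : X ⟶ P) : (c ≫ snd) ≫ g = (c ≫ fst) ≫ f := by
      rw [Strict.assoc, ← H.w, Strict.assoc]
    obtain ⟨ψ', h₁, h₂⟩ := H'.exists_lift₂ (φ ▷ f) ψ (w' a) (w' b)
      (Strict.assoc _ _ _) (Strict.assoc _ _ _) ((TwoCellEq.assoc_right _ _ _).symm.trans e)
    obtain ⟨γ, h₃, h₄⟩ := H.exists_lift₂ φ ψ' rfl rfl rfl rfl h₁.symm
    exact ⟨γ, h₃, (TwoCellEq.assoc_right _ _ _).trans ((TwoCellEq.whiskerRight rfl h₄).trans h₂)⟩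
  · refine H.hom₂_ext e (.of_eq (H'.hom₂_ext ?_ ?_))
    · exact (H.whiskerRight_w γ).symm.trans
        ((TwoCellEq.whiskerRight rfl e).trans (H.whiskerRight_w γ'))
    · exact (TwoCellEq.assoc_right _ _ _).symm.trans (e'.trans (TwoCellEq.assoc_right _ _ _))

theorem of_iso_comp {Q : K} {j : Q ⟶ P} {k : P ⟶ Q} (hjk : j ≫ k = 𝟙 Q) (hkj : k ≫ j = 𝟙 P)
    (p : P ⟶ A) : IsTwoPullback (j ≫ p) j (𝟙 A) p := by
  have comp_comp_inv {X : K} (a : X ⟶ Q) : (a ≫ j) ≫ k = a := by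
    rw [Strict.assoc, hjk, Strict.comp_id]
  have comp_inv_comp {X : K} (b : X ⟶ P) : (b ≫ k) ≫ j = b := by
    rw [Strict.assoc, hkj, Strict.comp_id]
  have whiskerRight_inv {X : K} {a b : X ⟶ Q} (γ : a ⟶ b) : γ ▷ j ▷ k ≗ γ :=
    (TwoCellEq.assoc_right _ _ _).symm.trans
      ((TwoCellEq.whiskerRight hjk (.refl _)).trans (TwoCellEq.id_right _))
  refine of_exists_of_ext (Strict.comp_id _) (fun x y e => ?_) (fun {X a b} _ e => ?_)
    (fun a b φ ψ e => ?_) (fun _ e => ?_)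
  · exact ⟨y ≫ k, by rw [← Strict.assoc, comp_inv_comp, ← e, Strict.comp_id], comp_inv_comp y⟩
  · rw [← comp_comp_inv a, e, comp_comp_inv]
  · obtain ⟨γ, hγ⟩ := TwoCellEq.exists_of_eq (comp_comp_inv a) (comp_comp_inv b) (ψ ▷ k)
    have hψ : γ ▷ j ≗ ψ :=
      (TwoCellEq.whiskerRight rfl hγ).trans <| (TwoCellEq.assoc_right _ _ _).symm.trans <|
        (TwoCellEq.whiskerRight hkj (.refl _)).trans (TwoCellEq.id_right _)
    exact ⟨γ, (TwoCellEq.assoc_right _ _ _).trans <| (TwoCellEq.whiskerRight rfl hψ).trans <|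
      e.symm.trans (TwoCellEq.id_right _), hψ⟩
  · exact ((whiskerRight_inv _).symm.trans
      ((TwoCellEq.whiskerRight rfl e).trans (whiskerRight_inv _))).eq

theorem of_iso (H : IsTwoPullback fst snd f g) {Q : K} {j : Q ⟶ P} {k : P ⟶ Q}
    (hjk : j ≫ k = 𝟙 Q) (hkj : k ≫ j = 𝟙 P) : IsTwoPullback (j ≫ fst) (j ≫ snd) f g := by
  simpa only [Strict.id_comp] using (of_iso_comp hjk hkj fst).paste H

theorem id_vert (p : A ⟶ B) : IsTwoPullback p (𝟙 A) (𝟙 B) p := by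
  simpa only [Strict.id_comp] using
    of_iso_comp (Strict.id_comp (𝟙 A)) (Strict.id_comp (𝟙 A)) p

theorem exists_iso (H : IsTwoPullback fst snd f g) {P' : K} {fst' : P' ⟶ A} {snd' : P' ⟶ B}
    (H' : IsTwoPullback fst' snd' f g) : ∃ (j : P ⟶ P') (k : P' ⟶ P), j ≫ k = 𝟙 P ∧ k ≫ j = 𝟙 P' ∧
      j ≫ fst' = fst ∧ j ≫ snd' = snd := by
  obtain ⟨j, hj, hj'⟩ := H'.exists_lift fst snd H.w
  obtain ⟨k, hk, hk'⟩ := H.exists_lift fst' snd' H'.w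
  refine ⟨j, k, H.hom_ext ?_ ?_, H'.hom_ext ?_ ?_, hj, hj'⟩ <;>
    simp only [hj', hk', hj, hk, Strict.assoc, Strict.id_comp]

end IsTwoPullback

/-! ### Two-cells of the arrow 2-category -/

section LiesOver

variable {K : Type u} [Bicategory.{w, v} K] {P B E C : K}

/-- The pair `(l, φ)` is a 2-cell of the 2-category of arrows of `K`, between commutative squares
`(x, f)` and `(z, g)` from `p` to `u`. -/
def LiesOver (p : P ⟶ B) (u : E ⟶ C) {x z : P ⟶ E} {f g : B ⟶ C} (l : x ⟶ z) (φ : f ⟶ g) : Prop :=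
  l ▷ u ≗ p ◁ φ

namespace LiesOver

variable {p : P ⟶ B} {u : E ⟶ C} {x y z : P ⟶ E} {f g k : B ⟶ C} {l : x ⟶ y} {φ : f ⟶ g}

theorem id (w : x ≫ u = p ≫ f) : LiesOver p u (𝟙 x) (𝟙 f) := by
  unfold LiesOver
  rw [Bicategory.id_whiskerRight, Bicategory.whiskerLeft_id]
  exact TwoCellEq.id_congr w

theorem comp (h : LiesOver p u l φ) {l' : y ⟶ z} {φ' : g ⟶ k} (h' : LiesOver p u l' φ') :
    LiesOver p u (l ≫ l') (φ ≫ φ') := by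
  unfold LiesOver
  rw [Bicategory.comp_whiskerRight, Bicategory.whiskerLeft_comp]
  exact TwoCellEq.comp' h h'

theorem comp_mid (h : LiesOver p u l φ) {x' y' : P ⟶ E} {f' g' : B ⟶ C} {l' : x' ⟶ y'}
    {φ' : f' ⟶ g'} (h' : LiesOver p u l' φ') (e : y = x') (e' : g = f') :
    LiesOver p u (l ≫ eqToHom e ≫ l') (φ ≫ eqToHom e' ≫ φ') := by
  subst e e'
  simpa only [eqToHom_refl, Category.id_comp] using h.comp h'

theorem congr (h : LiesOver p u l φ) {x' y' : P ⟶ E} {f' g' : B ⟶ C} {l' : x' ⟶ y'}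
    {φ' : f' ⟶ g'} (hl : l' ≗ l) (hφ : φ ≗ φ') : LiesOver p u l' φ' :=
  (TwoCellEq.whiskerRight rfl hl).trans (h.trans (TwoCellEq.whiskerLeft rfl hφ))

variable [Strict K]

theorem unique (h : LiesOver p u l φ) (hu : IsDiscreteOpfibration u) {x' y' : P ⟶ E}
    {l' : x' ⟶ y'} (h' : LiesOver p u l' φ) (hx : x = x') : l ≗ l' :=
  hu.unique_of_eq hx (h.trans h'.symm)

theorem precomp (h : LiesOver p u l φ) {Q : K} (a : Q ⟶ P) : LiesOver (a ≫ p) u (a ◁ l) φ :=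
  (TwoCellEq.assoc_mid _ _ _).trans <|
    (TwoCellEq.whiskerLeft rfl h).trans (TwoCellEq.assoc_left _ _ _).symm

theorem whiskerLeft (h : LiesOver p u l φ) {Q A : K} {a : Q ⟶ P} {q : Q ⟶ A} {b : A ⟶ B}
    (w : a ≫ p = q ≫ b) : LiesOver q u (a ◁ l) (b ◁ φ) :=
  (h.precomp a).trans <| (TwoCellEq.whiskerLeft w (.refl _)).trans (TwoCellEq.assoc_left _ _ _)

theorem whiskerRight (h : LiesOver p u l φ) {E' C' : K} {e : E ⟶ E'} {u' : E' ⟶ C'} {c : C ⟶ C'}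
    (w : u ≫ c = e ≫ u') : LiesOver p u' (l ▷ e) (φ ▷ c) :=
  (TwoCellEq.assoc_right _ _ _).symm.trans <| (TwoCellEq.whiskerRight w.symm (.refl _)).trans <|
    (TwoCellEq.assoc_right _ _ _).trans <| (TwoCellEq.whiskerRight rfl h).trans <|
    TwoCellEq.assoc_mid _ _ _

theorem map (h : LiesOver p u l φ) {L : Type*} [Bicategory L] (T : StrictPseudofunctor K L) :
    LiesOver (T.map p) (T.map u) (T.map₂ l) (T.map₂ φ) :=
  (TwoCellEq.map₂_right T _ _).symm.trans <| (TwoCellEq.map₂ T h).trans (TwoCellEq.map₂_left T _ _)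

/-- Both composites have the shape of the right-hand side of the multiplication law of a lax
morphism. -/
theorem iterate {T : StrictPseudofunctor K K} {x : P ⟶ E} {f : B ⟶ C} {s : T.obj P ⟶ P}
    {t : T.obj B ⟶ B} {e : T.obj E ⟶ E} {c : T.obj C ⟶ C} {l : T.map x ≫ e ⟶ s ≫ x}
    {φ : T.map f ≫ c ⟶ t ≫ f} (h : LiesOver (T.map p) u l φ) (hu : T.map u ≫ c = e ≫ u)
    (hp : s ≫ p = T.map p ≫ t) (hx : T.map (s ≫ x) ≫ e = T.map s ≫ T.map x ≫ e)
    (hf : T.map (t ≫ f) ≫ c = T.map t ≫ T.map f ≫ c) :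
    LiesOver (T.map (T.map p)) u (T.map₂ l ▷ e ≫ eqToHom hx ≫ T.map s ◁ l)
      (T.map₂ φ ▷ c ≫ eqToHom hf ≫ T.map t ◁ φ) :=
  ((h.map T).whiskerRight hu).comp_mid
    (h.whiskerLeft (by rw [← T.map_comp, hp, T.map_comp])) hx hf

end LiesOver

end LiesOver

/-! ### Two-cells between classifying maps -/

section IsGeneric

variable {K : Type u} [Bicategory.{w, v} K] {P B E C : K} {p : P ⟶ B} {x : P ⟶ E} {f : B ⟶ C}
  {u : E ⟶ C}

/-- For a discrete opfibration `u`, the square `(x, f)` from `p` to `u` is generic when 2-cells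
`f ⟶ g` correspond bijectively to maps `z` completing `g` to a square `(z, g)` from `p` to `u`. For
a pullback square this says that 2-cells `f ⟶ g` correspond to maps over `B` from `p` to the
pullback of `u` along `g`. -/
def IsGeneric (p : P ⟶ B) (x : P ⟶ E) (f : B ⟶ C) (u : E ⟶ C) : Prop :=
  ∀ (g : B ⟶ C) (z : P ⟶ E), z ≫ u = p ≫ g → ∃! φ : f ⟶ g, ∃ l : x ⟶ z, LiesOver p u l φ

theorem IsGeneric.twoCell_ext (H : IsGeneric p x f u) {g f' g' : B ⟶ C} {z x' z' : P ⟶ E}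
    {φ : f ⟶ g} {φ' : f' ⟶ g'} {l : x ⟶ z} {l' : x' ⟶ z'} (hl : LiesOver p u l φ)
    (hl' : LiesOver p u l' φ') (hf : f = f') (hg : g = g') (hx : x = x') (hz : z = z') :
    φ ≗ φ' := by
  subst hf hg hx hz
  exact .of_eq ((H g z hl.tgt).unique ⟨l, hl⟩ ⟨l', hl'⟩)

theorem IsGeneric.of_iso [Strict K] (H : IsGeneric p x f u) {Q : K} {j : Q ⟶ P} {k : P ⟶ Q}
    (hjk : j ≫ k = 𝟙 Q) (hkj : k ≫ j = 𝟙 P) : IsGeneric (j ≫ p) (j ≫ x) f u := by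
  intro g z hz
  have cancel {Y : K} (s : P ⟶ Y) : k ≫ j ≫ s = s := by rw [← Strict.assoc, hkj, Strict.id_comp]
  have cancel' : j ≫ k ≫ z = z := by rw [← Strict.assoc, hjk, Strict.id_comp]
  obtain ⟨φ, ⟨l, hl⟩, hφ⟩ := H g (k ≫ z) (by rw [Strict.assoc, hz, Strict.assoc, cancel])
  refine ⟨φ, ?_, ?_⟩
  · obtain ⟨l', hl'⟩ := TwoCellEq.exists_of_eq rfl cancel' (j ◁ l)
    exact ⟨l', (hl.precomp j).congr hl' (.refl φ)⟩
  · rintro ψ ⟨m, hm⟩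
    obtain ⟨m', hm'⟩ := TwoCellEq.exists_of_eq (cancel x) rfl (k ◁ m)
    have hkm := hm.precomp k
    rw [cancel] at hkm
    exact hφ ψ ⟨m', hkm.congr hm' (.refl ψ)⟩

end IsGeneric

/-! ### 2-classifiers -/

section Classifier

variable {K : Type u} [Bicategory.{w, v} K] [Enhanced K]

theorem IsPlumbus.isLeftTightPullback (hK : IsPlumbus K) {P A B C : K} {fst : P ⟶ A} {snd : P ⟶ B}
    {f : A ⟶ C} {g : B ⟶ C} (H : IsTwoPullback fst snd f g) (hg : IsTightDopf g)
    (hfst : IsTight fst) : IsLeftTightPullback fst snd f g :=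
  ⟨H, hg.tight, hfst, fun h hh => hK.detects_tight h fst ⟨hfst, H.dopf hg.dopf⟩ hh⟩

theorem IsTightDopf.id (B : K) : IsTightDopf (𝟙 B) := ⟨id_tight B, IsDiscreteOpfibration.id B⟩

theorem TdOpfib.pullbackFunctor_map_eq_iff (hK : IsPlumbus K) {E C B : K} {u : E ⟶ C}
    (hu : IsTightDopf u) {f g : B ⟶ C} (φ : f ⟶ g) (k : pullback hK u hu f ⟶ pullback hK u hu g) :
    (pullbackFunctor hK u hu B).map φ = k ↔
      ∃ l : pullbackSnd hK u hu f ⟶ k.map ≫ pullbackSnd hK u hu g,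
        LiesOver (pullback hK u hu f).hom u l φ := by
  have H := existsUnique_pullbackMap hK u hu φ
  constructor
  · rintro rfl
    exact H.choose_spec.1.exists_lift
  · rintro ⟨l, hl⟩
    exact TdOpfib.Hom.ext (H.unique H.choose_spec.1 ⟨k.w, l, hl⟩)

variable {Small : ∀ {E B : K}, (E ⟶ B) → Prop} {Ωpt Ω : K} {u : Ωpt ⟶ Ω}

theorem IsTwoClassifier.isGeneric {hK : IsPlumbus K} (hu : IsTwoClassifier hK Small u) {P B : K}
    {p : P ⟶ B} {x : P ⟶ Ωpt} {f : B ⟶ Ω} (H : IsTwoPullback p x f u) : IsGeneric p x f u := by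
  have pullback_isGeneric : IsGeneric (TdOpfib.pullback hK u hu.tightDopf f).hom
      (TdOpfib.pullbackSnd hK u hu.tightDopf f) f u := by
    intro g z hz
    obtain ⟨k, hk, rfl⟩ :=
      (TdOpfib.isLeftTightPullback hK u hu.tightDopf g).toIsTwoPullback.exists_lift _ z hz.symm
    obtain ⟨φ, hφ⟩ := (hu.full B).map_surjective (X := f) (Y := g) ⟨k, hk⟩
    refine ⟨φ, (TdOpfib.pullbackFunctor_map_eq_iff hK hu.tightDopf φ ⟨k, hk⟩).1 hφ, fun ψ hψ => ?_⟩
    exact (hu.faithful B).map_injective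
      (((TdOpfib.pullbackFunctor_map_eq_iff hK hu.tightDopf ψ ⟨k, hk⟩).2 hψ).trans hφ.symm)
  obtain ⟨j, k, hjk, hkj, rfl, rfl⟩ :=
    H.exists_iso (TdOpfib.isLeftTightPullback hK u hu.tightDopf f).toIsTwoPullback
  exact pullback_isGeneric.of_iso hjk hkj

theorem IsTwoClassifier.of_isGeneric (hK : IsPlumbus K) (hS : IsPullbackIdeal Small) (hu : Small u)
    (isGeneric : ∀ {P B : K} {p : P ⟶ B} {x : P ⟶ Ωpt} {f : B ⟶ Ω},
      IsLeftTightPullback p x f u → IsGeneric p x f u)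
    (exists_classifying : ∀ {E B : K} (p : E ⟶ B), Small p →
      ∃ (d : B ⟶ Ω) (x : E ⟶ Ωpt), IsTwoPullback p x d u) :
    IsTwoClassifier hK Small u := by
  have hu' := hS.tightDopf u hu
  have H {B : K} (f : B ⟶ Ω) := TdOpfib.isLeftTightPullback hK u hu' f
  have existsUnique_map {B : K} {f g : B ⟶ Ω}
      (k : TdOpfib.pullback hK u hu' f ⟶ TdOpfib.pullback hK u hu' g) :
      ∃! φ : f ⟶ g, (TdOpfib.pullbackFunctor hK u hu' B).map φ = k := by
    simp only [TdOpfib.pullbackFunctor_map_eq_iff]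
    refine isGeneric (H f) g _ ?_
    rw [Strict.assoc, ← (H g).w, ← Strict.assoc, TdOpfib.Hom.w]
  refine ⟨hu, hu', fun B => ⟨fun {f g} k => (existsUnique_map (f := f) (g := g) k).exists⟩,
    fun B => ⟨fun {f g φ ψ} e => (existsUnique_map (f := f) (g := g) _).unique e rfl⟩,
    fun {B} p => ⟨?_, fun hp => ?_⟩⟩
  · rintro ⟨f, ⟨e⟩⟩
    exact hS.replete _ p.hom (hS.pullback _ _ _ _ hu (H f)) p.isTightDopf e.hom.map e.inv.map
      (congrArg TdOpfib.Hom.map e.hom_inv_id) (congrArg TdOpfib.Hom.map e.inv_hom_id) e.hom.w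
  · obtain ⟨d, x, Hd⟩ := exists_classifying p.hom hp
    obtain ⟨j, k, hjk, hkj, hj, -⟩ := (H d).toIsTwoPullback.exists_iso Hd
    have hk : k ≫ (TdOpfib.pullback hK u hu' d).hom = p.hom := by
      rw [← hj, ← Strict.assoc, hkj, Strict.id_comp]
    exact ⟨d, ⟨⟨⟨j, hj⟩, ⟨k, hk⟩, TdOpfib.Hom.ext hjk, TdOpfib.Hom.ext hkj⟩⟩⟩

namespace IsRepresentablePlumbus

variable (hK : IsRepresentablePlumbus Small u)
include hK

theorem tightDopf : IsTightDopf u := hK.isTwoClassifier.tightDopf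

theorem exists_classifying {E B : K} (p : E ⟶ B) (hp : Small p) :
    ∃ (d : B ⟶ Ω) (x : E ⟶ Ωpt), IsTwoPullback p x d u := by
  obtain ⟨d, ⟨e⟩⟩ := (hK.isTwoClassifier.essImage_iff
    ⟨E, p, hK.isPullbackIdeal.tightDopf p hp⟩).2 hp
  have H := (TdOpfib.isLeftTightPullback hK.isPlumbus u hK.tightDopf d).toIsTwoPullback.of_iso
    (congrArg TdOpfib.Hom.map e.inv_hom_id) (congrArg TdOpfib.Hom.map e.hom_inv_id)
  exact ⟨d, _, e.inv.w ▸ H⟩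

theorem small_identity (B : K) : Small (𝟙 B) := by
  obtain ⟨t, ht⟩ := hK.isPlumbus.exists_terminal
  obtain ⟨f, -⟩ := ht B
  exact hK.isPullbackIdeal.pullback _ f f _ (hK.small_id t ht)
    ⟨(IsTwoPullback.id_vert f).flip, id_tight t, id_tight B,
      fun h hh => by rwa [Strict.comp_id] at hh⟩

/-- Think of `c` as constant at the one-point set and of `χ` as the tautological point of each
pointed set. The 2-cell `φ : k ⟶ k` that corresponds to `z` restricts to an identity along `c`,
since `𝟙 P` has no other endomorphism over `P`; by exchange, `φ` then fixes every point. -/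
theorem eq_of_isTwoPullback {P B : K} {p : P ⟶ B} {x y z : P ⟶ Ωpt} {k : B ⟶ Ω} {c : P ⟶ B}
    (H : IsTwoPullback p x k u) (hz : z ≫ u = p ≫ k) (H' : IsTwoPullback (𝟙 P) y (c ≫ k) u)
    (χ : c ⟶ p) (μ : y ⟶ x) (hμ : μ ▷ u ≗ χ ▷ k) : z = x := by
  have hu : IsDiscreteOpfibration u := hK.tightDopf.dopf
  have hy : y ≫ u = c ≫ k := H'.w.symm.trans (Strict.id_comp _)
  obtain ⟨φ, ⟨l, hl⟩, -⟩ := hK.isTwoClassifier.isGeneric H k z hz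
  obtain ⟨w, m, hm⟩ := hu.exists_lift y (c ◁ φ) hy
  have hw : w = y := by
    obtain ⟨t, ht, rfl⟩ := H'.exists_lift (𝟙 P) w (by rw [Strict.id_comp, hm.tgt])
    rw [Strict.comp_id] at ht
    rw [ht, Strict.id_comp]
  have hφ : c ◁ φ = 𝟙 (c ≫ k) :=
    ((hK.isTwoClassifier.isGeneric H').twoCell_ext (hm.trans (TwoCellEq.id_left _).symm)
      (LiesOver.id H'.w.symm) rfl rfl rfl hw).eq
  have exchange := whisker_exchange χ φ
  rw [hφ, Category.id_comp] at exchange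
  refine (hu.unique (μ ≫ l) μ ?_).tgt
  rw [Bicategory.comp_whiskerRight]
  exact (TwoCellEq.comp' hμ hl).trans ((TwoCellEq.of_eq exchange.symm).trans hμ.symm)

end IsRepresentablePlumbus

end Classifier

/-! ### The algebra structure on pointed objects -/

section ClassifierAlgebra

variable {K : Type u} [Bicategory.{w, v} K] [Enhanced K]
  {Small : ∀ {E B : K}, (E ⟶ B) → Prop} {Ωpt Ω : K} {u : Ωpt ⟶ Ω} {M : EnhancedTwoMonad K}

/-- The 2-monad `M` preserves pullbacks of `u`: it sends left-tight pullbacks of `u` along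
arbitrary maps to pullbacks. -/
def EnhancedTwoMonad.PreservesPullbacks (M : EnhancedTwoMonad K) {Ωpt Ω : K} (u : Ωpt ⟶ Ω) : Prop :=
  ∀ {P B : K} (p : P ⟶ B) (x : P ⟶ Ωpt) (f : B ⟶ Ω), IsLeftTightPullback p x f u →
    IsTwoPullback (M.T.map p) (M.T.map x) (M.T.map f) (M.T.map u)

namespace IsRepresentablePlumbus

variable (hK : IsRepresentablePlumbus Small u) {ω : M.T.obj Ω ⟶ Ω} {ωpt : M.T.obj Ωpt ⟶ Ωpt}
  (hω : IsTwoPullback (M.T.map u) ωpt ω u)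
include hK

theorem exists_tautologicalPoint :
    ∃ (c : Ωpt ⟶ Ω) (y : Ωpt ⟶ Ωpt) (χ : c ⟶ u) (μ : y ⟶ 𝟙 Ωpt),
      IsTwoPullback (𝟙 Ωpt) y c u ∧ LiesOver (𝟙 Ωpt) u μ χ := by
  obtain ⟨c, y, Hc⟩ := hK.exists_classifying (𝟙 Ωpt) (hK.small_identity Ωpt)
  obtain ⟨χ, ⟨μ, hμ⟩, -⟩ := hK.isTwoClassifier.isGeneric Hc u (𝟙 Ωpt) rfl
  exact ⟨c, y, χ, μ, Hc, hμ⟩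

include hω

theorem map_isTwoPullback (hT : M.PreservesPullbacks u) {P B : K} {p : P ⟶ B} {x : P ⟶ Ωpt}
    {f : B ⟶ Ω} (H : IsTwoPullback p x f u) (hp : IsTight p) :
    IsTwoPullback (M.T.map p) (M.T.map x ≫ ωpt) (M.T.map f ≫ ω) u :=
  (hT p x f (hK.isPlumbus.isLeftTightPullback H hK.tightDopf hp)).paste hω

theorem isTight_str (hω_tight : IsTight ω) : IsTight ωpt := by
  refine hK.isPlumbus.detects_tight _ u hK.tightDopf ?_
  rw [← hω.w]
  exact comp_tight (M.map_tight u hK.tightDopf.tight) hω_tight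

theorem str_unit (hω_unit : M.i Ω ≫ ω = 𝟙 Ω) : M.i Ωpt ≫ ωpt = 𝟙 Ωpt := by
  obtain ⟨c, y, χ, μ, Hc, hμ⟩ := hK.exists_tautologicalPoint
  refine hK.eq_of_isTwoPullback (IsTwoPullback.id_vert u) ?_ (c := c) (y := y) ?_ χ μ
    (hμ.trans ((TwoCellEq.id_left _).trans (TwoCellEq.id_right _).symm))
  · rw [Strict.assoc, ← hω.w, ← Strict.assoc, ← M.i_naturality, Strict.assoc, hω_unit]
  · rwa [Strict.comp_id]

theorem str_assoc (hT : M.PreservesPullbacks u) (hω_assoc : M.m Ω ≫ ω = M.T.map ω ≫ ω) :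
    M.m Ωpt ≫ ωpt = M.T.map ωpt ≫ ωpt := by
  obtain ⟨c, y, χ, μ, Hc, hμ⟩ := hK.exists_tautologicalPoint
  have Hu := hK.map_isTwoPullback hω hT hω (M.map_tight u hK.tightDopf.tight)
  have HTTc := hK.map_isTwoPullback hω hT (hK.map_isTwoPullback hω hT Hc (id_tight _))
    (M.map_tight _ (id_tight _))
  have hμ' := (((hμ.map M.T).whiskerRight hω.w).map M.T).whiskerRight hω.w
  have map_id_comp : M.T.map (M.T.map (𝟙 Ωpt) ≫ ωpt) ≫ ωpt = M.T.map ωpt ≫ ωpt := by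
    rw [M.T.map_id, Strict.id_comp]
  have map_map_comp : M.T.map (M.T.map c ≫ ω) ≫ ω = M.T.map (M.T.map c) ≫ M.T.map ω ≫ ω := by
    rw [M.T.map_comp, Strict.assoc]
  have map_map_id : M.T.map (M.T.map (𝟙 Ωpt)) = 𝟙 (M.T.obj (M.T.obj Ωpt)) := by
    rw [M.T.map_id, M.T.map_id]
  rw [map_map_id, map_map_comp] at HTTc
  obtain ⟨ν, hν⟩ := TwoCellEq.exists_of_eq rfl map_id_comp (M.T.map₂ (M.T.map₂ μ ▷ ωpt) ▷ ωpt)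
  refine hK.eq_of_isTwoPullback Hu ?_ HTTc (M.T.map₂ (M.T.map₂ χ)) ν ?_
  · rw [Strict.assoc, ← hω.w, ← Strict.assoc, ← M.m_naturality, Strict.assoc, hω_assoc]
  · exact (TwoCellEq.whiskerRight rfl hν).trans <| hμ'.trans <|
      (TwoCellEq.whiskerLeft map_map_id (.refl _)).trans <| (TwoCellEq.id_left _).trans <|
      (TwoCellEq.whiskerRight rfl (TwoCellEq.map₂_right M.T _ _)).trans
        (TwoCellEq.assoc_right _ _ _).symm

end IsRepresentablePlumbus

end ClassifierAlgebra

/-! ### Algebras, strict morphisms and laxators -/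

theorem TwoCellEq.map₂_whiskerRight {K L : Type*} [Bicategory K] [Strict K] [Bicategory L]
    [Strict L] (T : StrictPseudofunctor K L) {X E B : K} {E' B' : L} {p : E ⟶ B} {p' : E' ⟶ B'}
    {η : T.obj E ⟶ E'} {β : T.obj B ⟶ B'} (w : T.map p ≫ β = η ≫ p') {f g : X ⟶ E} {γ : f ⟶ g}
    {f' g' : X ⟶ B} {φ : f' ⟶ g'} (h : γ ▷ p ≗ φ) : T.map₂ γ ▷ η ▷ p' ≗ T.map₂ φ ▷ β :=
  (assoc_right _ _ _).symm.trans <| (whiskerRight w.symm (.refl _)).trans <|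
    (assoc_right _ _ _).trans <| whiskerRight rfl <| (map₂_right T γ p).symm.trans (map₂ T h)

namespace Alg

variable {K : Type u} [Bicategory.{w, v} K] [Enhanced K] {M : EnhancedTwoMonad K}

section Laxators

variable {A B C X E : Alg M}

theorem i_comp_map_comp_str {X : K} (e : X ⟶ E.carrier) : M.i X ≫ M.T.map e ≫ E.str = e := by
  rw [← Strict.assoc, ← M.i_naturality, Strict.assoc, E.unit, Strict.comp_id]

theorem m_comp_map_comp_str {X : K} (e : X ⟶ E.carrier) :
    M.m X ≫ M.T.map e ≫ E.str = M.T.map (M.T.map e ≫ E.str) ≫ E.str := by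
  rw [M.T.map_comp, Strict.assoc, ← E.assoc, ← Strict.assoc, ← M.m_naturality, Strict.assoc]

theorem LaxHom.IsStrict.w {f : A ⟶ B} (hf : f.IsStrict) :
    M.T.map f.hom ≫ B.str = A.str ≫ f.hom :=
  TwoCellEq.src hf

theorem LaxHom.isStrict_ofStrict (f : A.carrier ⟶ B.carrier)
    (hf : M.T.map f ≫ B.str = A.str ≫ f) : (LaxHom.ofStrict f hf).IsStrict :=
  (TwoCellEq.eqToHom_id hf).trans (TwoCellEq.id_congr hf)

theorem laxator_congr {f g : A ⟶ B} (h : f = g) : f.laxator ≗ g.laxator := by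
  subst h
  exact .refl _

theorem comp_laxator_of_right (f : A ⟶ B) {g : B ⟶ C} (hg : g.IsStrict) :
    (f ≫ g).laxator ≗ f.laxator ▷ g.hom := by
  refine (f.compLaxator_eq g).trans (TwoCellEq.id_comp_mid (η := M.T.map f.hom ◁ g.laxator) ?_ _ _)
  refine (TwoCellEq.whiskerLeft rfl hg).trans ?_
  rw [Bicategory.whiskerLeft_id]
  exact TwoCellEq.id_congr (congrArg (M.T.map f.hom ≫ ·) hg.w).symm

theorem comp_laxator_of_left {f : A ⟶ B} (hf : f.IsStrict) (g : B ⟶ C) :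
    (f ≫ g).laxator ≗ M.T.map f.hom ◁ g.laxator := by
  refine (f.compLaxator_eq g).trans (TwoCellEq.comp_id_mid (M.T.map f.hom ◁ g.laxator) _ ?_)
  refine (TwoCellEq.whiskerRight rfl hf).trans ?_
  rw [Bicategory.id_whiskerRight]
  exact TwoCellEq.id_congr (congrArg (· ≫ g.hom) hf.w).symm

theorem laxator_liesOver {p : E ⟶ B} {q : X ⟶ A} {x : E ⟶ X} {d : B ⟶ A} (hp : p.IsStrict)
    (hq : q.IsStrict) (w : p ≫ d = x ≫ q) :
    LiesOver (M.T.map p.hom) q.hom x.laxator d.laxator :=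
  (comp_laxator_of_right x hq).symm.trans
    ((laxator_congr w.symm).trans (comp_laxator_of_left hp d))

theorem hom₂_congr {f g f' g' : A ⟶ B} {η : f ⟶ g} {θ : f' ⟶ g'} (h : η ≗ θ) :
    η.hom₂ ≗ θ.hom₂ := by
  obtain ⟨rfl, rfl, rfl⟩ := h
  exact .of_eq (by simp)

theorem twoCellEq_of_hom₂ {f g f' g' : A ⟶ B} {η : f ⟶ g} {θ : f' ⟶ g'}
    (hf : f = f') (hg : g = g') (h : η.hom₂ ≗ θ.hom₂) : η ≗ θ := by
  subst hf hg
  exact .of_eq (LaxHom₂.ext h.eq)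

end Laxators

section Lifting

variable {X E B : Alg M} {p : E ⟶ B} (hp : p.IsStrict) (hd : IsDiscreteOpfibration p.hom)
include hp hd

/-- The lift along a strict discrete opfibration `p` of a lax morphism `b`: a 2-cell `l` over the
laxator of `b` satisfies the laws of a laxator, since these hold over the base and lifts are
unique. -/
def LaxHom.lift (b : X ⟶ B) (e : X.carrier ⟶ E.carrier) (l : M.T.map e ≫ E.str ⟶ X.str ≫ e)
    (hl : l ▷ p.hom ≗ b.laxator) : X ⟶ E where
  hom := e
  laxator := l
  unit := by
    refine (hd.eq_id (b := b.hom) ?_).trans (TwoCellEq.id_congr (i_comp_map_comp_str e))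
    exact (TwoCellEq.assoc_mid _ _ _).trans ((TwoCellEq.whiskerLeft rfl hl).trans b.unit)
  mul := by
    refine hd.unique_of_eq (m_comp_map_comp_str e) ?_
    refine (TwoCellEq.assoc_mid _ _ _).trans <| (TwoCellEq.whiskerLeft rfl hl).trans <|
      b.mul.trans <| TwoCellEq.symm <| (TwoCellEq.whiskerRight_mid _ _ _ _).trans ?_
    exact TwoCellEq.compMid (TwoCellEq.map₂_whiskerRight M.T hp.w hl)
      ((TwoCellEq.assoc_mid _ _ _).trans (TwoCellEq.whiskerLeft rfl hl))

theorem LaxHom.lift_comp (b : X ⟶ B) {e : X.carrier ⟶ E.carrier}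
    (l : M.T.map e ≫ E.str ⟶ X.str ≫ e) (hl : l ▷ p.hom ≗ b.laxator) (he : e ≫ p.hom = b.hom) :
    LaxHom.lift hp hd b e l hl ≫ p = b :=
  LaxHom.ext he ((comp_laxator_of_right _ hp).trans hl)

theorem LaxHom.ext_of_comp {e e' : X ⟶ E} (h : e.hom = e'.hom) (h' : e ≫ p = e' ≫ p) : e = e' :=
  LaxHom.ext h <| hd.unique_of_eq (by rw [h]) <| (comp_laxator_of_right e hp).symm.trans <|
    (laxator_congr h').trans (comp_laxator_of_right e' hp)

theorem LaxHom.isStrict_of_comp {e : X ⟶ E} (h : (e ≫ p).IsStrict) : e.IsStrict := by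
  have := hd.eq_id ((comp_laxator_of_right e hp).symm.trans h)
  exact this.trans (TwoCellEq.id_congr this.tgt.symm)

theorem map₂_comp_laxator {e : X ⟶ E} {a b : X ⟶ B} (h : e ≫ p = a) (Φ : a ⟶ b)
    {e' : X.carrier ⟶ E.carrier} {l : e.hom ⟶ e'} (hl : l ▷ p.hom ≗ Φ.hom₂)
    {t : M.T.obj X.carrier ⟶ E.carrier} {L : M.T.map e' ≫ E.str ⟶ t}
    (hL : L ▷ p.hom ≗ b.laxator) : M.T.map₂ l ▷ E.str ≫ L ≗ e.laxator ≫ X.str ◁ l := by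
  subst h
  refine hd.unique _ _ ?_
  rw [Bicategory.comp_whiskerRight, Bicategory.comp_whiskerRight]
  refine (TwoCellEq.comp' (TwoCellEq.map₂_whiskerRight M.T hp.w hl) hL).trans ?_
  refine (TwoCellEq.of_eq Φ.w).trans ?_
  exact TwoCellEq.comp' (comp_laxator_of_right e hp)
    ((TwoCellEq.whiskerLeft rfl hl.symm).trans (TwoCellEq.assoc_mid _ _ _).symm)

/-- The lift along a strict discrete opfibration `p` of a `T`-2-morphism `Φ`: a 2-cell `γ` over `Φ`
is compatible with the laxators, since it is so over the base and lifts are unique. -/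
def LaxHom₂.lift {f g : X ⟶ E} (γ : f.hom ⟶ g.hom) (Φ : f ≫ p ⟶ g ≫ p)
    (h : γ ▷ p.hom ≗ Φ.hom₂) : f ⟶ g where
  hom₂ := γ
  w := (map₂_comp_laxator hp hd rfl Φ h (comp_laxator_of_right g hp).symm).eq

theorem isDiscreteOpfibration_of_hom : IsDiscreteOpfibration p := by
  refine IsDiscreteOpfibration.of_exists_of_unique (fun {X} e b Φ => ?_)
    (fun {X} e e₁ e₂ l₁ l₂ h => ?_)
  · obtain ⟨e', l, hl⟩ := hd.exists_lift e.hom Φ.hom₂ rfl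
    have he' : (M.T.map e' ≫ E.str) ≫ p.hom = M.T.map b.hom ≫ B.str := by
      rw [Strict.assoc, ← hp.w, ← Strict.assoc, ← M.T.map_comp, hl.tgt]
    obtain ⟨t, L, hL⟩ := hd.exists_lift (M.T.map e' ≫ E.str) b.laxator he'
    have hw := map₂_comp_laxator hp hd rfl Φ hl hL
    obtain rfl := hw.tgt
    exact ⟨LaxHom.lift hp hd b e' L hL, ⟨l, hw.eq⟩,
      twoCellEq_of_hom₂ rfl (LaxHom.lift_comp hp hd b L hL hl.tgt) hl⟩
  · have h₁ : l₁.hom₂ ≗ l₂.hom₂ := hd.unique _ _ (hom₂_congr h)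
    exact twoCellEq_of_hom₂ rfl (LaxHom.ext_of_comp hp hd h₁.tgt h.tgt) h₁

end Lifting

/-! ### Free algebras -/

section Free

variable {X : K} {E B : Alg M}

/-- The free algebra on `X`: strict morphisms out of it are maps out of `X`. -/
def free (M : EnhancedTwoMonad K) (X : K) : Alg M where
  carrier := M.T.obj X
  str := M.m X
  str_tight := M.m_tight X
  unit := M.i_m X
  assoc := (M.assoc X).symm

/-- The strict morphism out of a free algebra induced by a map. -/
def freeDesc (e : X ⟶ E.carrier) : free M X ⟶ E :=
  LaxHom.ofStrict (M.T.map e ≫ E.str) (m_comp_map_comp_str e).symm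

theorem freeDesc_isStrict (e : X ⟶ E.carrier) : (freeDesc e).IsStrict :=
  LaxHom.isStrict_ofStrict _ (m_comp_map_comp_str e).symm

/-- The `T`-2-morphism out of a free algebra induced by a 2-cell. -/
def freeDesc₂ {e e' : X ⟶ E.carrier} (φ : e ⟶ e') :
    (freeDesc e : free M X ⟶ E) ⟶ freeDesc e' where
  hom₂ := M.T.map₂ φ ▷ E.str
  w := by
    refine TwoCellEq.eq <| (TwoCellEq.eqToHom_right (m_comp_map_comp_str e').symm _).trans <|
      TwoCellEq.trans ?_ (TwoCellEq.eqToHom_left (m_comp_map_comp_str e).symm _).symm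
    exact (TwoCellEq.whiskerRight rfl (TwoCellEq.map₂_right M.T _ _)).trans <|
      (TwoCellEq.assoc_right _ _ _).symm.trans <|
      (TwoCellEq.whiskerRight E.assoc.symm (.refl _)).trans <|
      (TwoCellEq.assoc_right _ _ _).trans <|
      (TwoCellEq.whiskerRight rfl (M.m_naturality₂ φ)).trans <| TwoCellEq.assoc_mid _ _ _

theorem i_whiskerLeft_freeDesc₂ {e e' : X ⟶ E.carrier} (φ : e ⟶ e') :
    M.i X ◁ (freeDesc₂ φ : (freeDesc e : free M X ⟶ E) ⟶ _).hom₂ ≗ φ :=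
  (TwoCellEq.assoc_mid _ _ _).symm.trans <|
    (TwoCellEq.whiskerRight rfl (M.i_naturality₂ φ).symm).trans <|
    (TwoCellEq.assoc_right _ _ _).symm.trans <|
    (TwoCellEq.whiskerRight E.unit (.refl _)).trans <| TwoCellEq.id_right _

theorem freeDesc_comp (e : X ⟶ E.carrier) {p : E ⟶ B} (hp : p.IsStrict) :
    freeDesc e ≫ p = freeDesc (e ≫ p.hom) := by
  have h : (M.T.map e ≫ E.str) ≫ p.hom = M.T.map (e ≫ p.hom) ≫ B.str := by
    rw [Strict.assoc, ← hp.w, ← Strict.assoc, ← M.T.map_comp]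
  exact LaxHom.ext h <| (LaxHom.isStrict_comp (freeDesc_isStrict e) hp).trans <|
    (TwoCellEq.id_congr (congrArg ((free M X).str ≫ ·) h)).trans (freeDesc_isStrict _).symm

theorem isDiscreteOpfibration_hom {p : E ⟶ B} (hp : p.IsStrict) (hd : IsDiscreteOpfibration p) :
    IsDiscreteOpfibration p.hom := by
  refine IsDiscreteOpfibration.of_exists_of_unique (fun {X} e b φ => ?_)
    (fun {X} e e₁ e₂ l₁ l₂ h => ?_)
  · obtain ⟨e', L, hL⟩ := hd.exists_lift (freeDesc e) (freeDesc₂ φ) (freeDesc_comp e hp)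
    obtain ⟨l, hl⟩ := TwoCellEq.exists_of_eq (i_comp_map_comp_str e) rfl (M.i X ◁ L.hom₂)
    refine ⟨_, l, (TwoCellEq.whiskerRight rfl hl).trans <| (TwoCellEq.assoc_mid _ _ _).trans ?_⟩
    exact (TwoCellEq.whiskerLeft rfl (hom₂_congr hL)).trans (i_whiskerLeft_freeDesc₂ φ)
  · have freeDesc₂_comp {a : X ⟶ E.carrier} (l : e ⟶ a) :
        (freeDesc₂ l ▷ p : (freeDesc e : free M X ⟶ E) ≫ p ⟶ _) ≗ freeDesc₂ (l ▷ p.hom) :=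
      twoCellEq_of_hom₂ (freeDesc_comp e hp) (freeDesc_comp a hp)
        (TwoCellEq.map₂_whiskerRight M.T hp.w (.refl _))
    have freeDesc₂_eq : freeDesc₂ (l₁ ▷ p.hom) ≗ freeDesc₂ (l₂ ▷ p.hom) :=
      twoCellEq_of_hom₂ rfl (congrArg freeDesc h.tgt)
        (TwoCellEq.whiskerRight rfl (TwoCellEq.map₂ M.T h))
    have key := hd.unique (freeDesc₂ l₁) (freeDesc₂ l₂)
      ((freeDesc₂_comp l₁).trans (freeDesc₂_eq.trans (freeDesc₂_comp l₂).symm))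
    exact (i_whiskerLeft_freeDesc₂ l₁).symm.trans
      ((TwoCellEq.whiskerLeft rfl (hom₂_congr key)).trans (i_whiskerLeft_freeDesc₂ l₂))

theorem isTightDopf_iff {p : E ⟶ B} : IsTightDopf p ↔ p.IsStrict ∧ IsTightDopf p.hom :=
  ⟨fun h => ⟨h.tight.1, h.tight.2, isDiscreteOpfibration_hom h.tight.1 h.dopf⟩,
    fun h => ⟨⟨h.1, h.2.tight⟩, isDiscreteOpfibration_of_hom h.1 h.2.dopf⟩⟩

end Free

/-! ### Pullbacks and terminal objects of algebras -/

section Pullbacks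

variable {P A E B : Alg M}

theorem exists_lift_of_hom {fst : P ⟶ A} {snd : P ⟶ E} {f : A ⟶ B} {p : E ⟶ B}
    (hfst : fst.IsStrict) (hp : p.IsStrict) (hd : IsDiscreteOpfibration p.hom)
    (w : fst ≫ f = snd ≫ p) (H : IsTwoPullback fst.hom snd.hom f.hom p.hom) {X : Alg M}
    (x : X ⟶ A) (y : X ⟶ E) (e : x ≫ f = y ≫ p) : ∃ h : X ⟶ P, h ≫ fst = x ∧ h ≫ snd = y := by
  have hfst' : IsDiscreteOpfibration fst.hom := H.dopf hd
  obtain ⟨h, hx, hy⟩ := H.exists_lift x.hom y.hom (congrArg LaxHom.hom e)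
  obtain ⟨t, l, hl⟩ := hfst'.exists_lift (M.T.map h ≫ P.str) x.laxator
    (by rw [Strict.assoc, ← hfst.w, ← Strict.assoc, ← M.T.map_comp, hx])
  have map_h : M.T.map h ≫ M.T.map fst.hom = M.T.map x.hom := by rw [← M.T.map_comp, hx]
  have laxator_y : M.T.map h ◁ snd.laxator ≫ eqToHom (Strict.assoc _ _ _).symm ≫ l ▷ snd.hom ≗
      y.laxator := by
    refine hd.unique_of_eq (by rw [← Strict.assoc, ← M.T.map_comp, hy]) ?_
    refine ((TwoCellEq.whiskerRight_mid _ _ _ _).trans (TwoCellEq.compMid ?_ ?_)).trans <|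
      (x.compLaxator_eq f).symm.trans <|
      (laxator_congr e).trans (comp_laxator_of_right y hp)
    · exact ((laxator_liesOver hfst hp w).precomp _).trans (TwoCellEq.whiskerLeft map_h (.refl _))
    · exact (TwoCellEq.assoc_right _ _ _).symm.trans <|
        (TwoCellEq.whiskerRight H.w.symm (.refl _)).trans <|
        (TwoCellEq.assoc_right _ _ _).trans (TwoCellEq.whiskerRight rfl hl)
  obtain rfl : t = X.str ≫ h := H.hom_ext (by rw [hl.tgt, Strict.assoc, hx])
    (by rw [laxator_y.tgt, Strict.assoc, hy])
  exact ⟨LaxHom.lift hfst hfst' x h l hl, LaxHom.lift_comp hfst hfst' x l hl hx,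
    LaxHom.ext hy ((LaxHom.compLaxator_eq _ _).trans laxator_y)⟩

theorem isTwoPullback_of_hom {fst : P ⟶ A} {snd : P ⟶ E} {f : A ⟶ B} {p : E ⟶ B}
    (hfst : fst.IsStrict) (hp : p.IsStrict) (hd : IsDiscreteOpfibration p.hom)
    (w : fst ≫ f = snd ≫ p) (H : IsTwoPullback fst.hom snd.hom f.hom p.hom) :
    IsTwoPullback fst snd f p := by
  have hfst' : IsDiscreteOpfibration fst.hom := H.dopf hd
  refine IsTwoPullback.of_exists_of_ext w (exists_lift_of_hom hfst hp hd w H) (fun e e' => ?_)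
    (fun h k φ ψ e => ?_) (fun e e' => ?_)
  · exact LaxHom.ext_of_comp hfst hfst'
      (H.hom_ext (congrArg LaxHom.hom e) (congrArg LaxHom.hom e')) e
  · obtain ⟨γ, h₁, h₂⟩ := H.exists_lift₂ φ.hom₂ ψ.hom₂ rfl rfl rfl rfl (hom₂_congr e)
    exact ⟨LaxHom₂.lift hfst hfst' γ φ h₁, twoCellEq_of_hom₂ rfl rfl h₁,
      twoCellEq_of_hom₂ rfl rfl h₂⟩
  · exact LaxHom₂.ext (H.hom₂_ext (hom₂_congr e) (hom₂_congr e'))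

theorem isLeftTightPullback_of_hom {fst : P ⟶ A} {snd : P ⟶ E} {f : A ⟶ B} {p : E ⟶ B}
    (hfst : fst.IsStrict) (hp : p.IsStrict) (hd : IsDiscreteOpfibration p.hom)
    (w : fst ≫ f = snd ≫ p) (H : IsLeftTightPullback fst.hom snd.hom f.hom p.hom) :
    IsLeftTightPullback fst snd f p where
  toIsTwoPullback := isTwoPullback_of_hom hfst hp hd w H.toIsTwoPullback
  right_tight := ⟨hp, H.right_tight⟩
  left_tight := ⟨hfst, H.left_tight⟩
  detects _ hh := ⟨LaxHom.isStrict_of_comp hfst (H.dopf hd) hh.1, H.detects _ hh.2⟩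

end Pullbacks

section PullbackAlgebra

variable {A E B : Alg M} {f : A ⟶ B} {p : E ⟶ B} {P : K} {fst : P ⟶ A.carrier}
  {snd : P ⟶ E.carrier}

theorem exists_pullback_str (hp : p.IsStrict) (hd : IsDiscreteOpfibration p.hom)
    (H : IsTwoPullback fst snd f.hom p.hom) :
    ∃ (π : M.T.obj P ⟶ P) (l : M.T.map snd ≫ E.str ⟶ π ≫ snd),
      π ≫ fst = M.T.map fst ≫ A.str ∧ LiesOver (M.T.map fst) p.hom l f.laxator := by
  have hw : (M.T.map snd ≫ E.str) ≫ p.hom = M.T.map fst ≫ M.T.map f.hom ≫ B.str := by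
    rw [Strict.assoc, ← hp.w, ← Strict.assoc, ← M.T.map_comp, ← H.w, M.T.map_comp, Strict.assoc]
  obtain ⟨s, l, hl⟩ := hd.exists_lift _ (M.T.map fst ◁ f.laxator) hw
  obtain ⟨π, hπ, rfl⟩ := H.exists_lift (M.T.map fst ≫ A.str) s (by rw [hl.tgt, Strict.assoc])
  exact ⟨π, l, hπ, hl⟩

variable {π : M.T.obj P ⟶ P} {l : M.T.map snd ≫ E.str ⟶ π ≫ snd}

theorem pullback_str_unit (hd : IsDiscreteOpfibration p.hom)
    (H : IsTwoPullback fst snd f.hom p.hom) (hπ : π ≫ fst = M.T.map fst ≫ A.str)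
    (hl : LiesOver (M.T.map fst) p.hom l f.laxator) : M.i P ≫ π = 𝟙 P := by
  have i_whiskerLeft : M.i P ◁ l ≗ 𝟙 (M.i P ≫ M.T.map snd ≫ E.str) := by
    refine hd.eq_id (b := fst ≫ f.hom) ?_
    exact (hl.whiskerLeft (M.i_naturality fst).symm).trans <|
      (TwoCellEq.whiskerLeft rfl f.unit).trans (.of_eq (Bicategory.whiskerLeft_id _ _))
  refine H.hom_ext ?_ ?_
  · rw [Strict.assoc, hπ, i_comp_map_comp_str, Strict.id_comp]
  · rw [Strict.assoc, i_whiskerLeft.tgt, i_comp_map_comp_str, Strict.id_comp]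

theorem pullback_str_assoc (hp : p.IsStrict) (hd : IsDiscreteOpfibration p.hom)
    (H : IsTwoPullback fst snd f.hom p.hom) (hπ : π ≫ fst = M.T.map fst ≫ A.str)
    (hl : LiesOver (M.T.map fst) p.hom l f.laxator) : M.m P ≫ π = M.T.map π ≫ π := by
  have map_snd : M.T.map (π ≫ snd) ≫ E.str = M.T.map π ≫ M.T.map snd ≫ E.str := by
    rw [M.T.map_comp, Strict.assoc]
  have m_whiskerLeft : M.m P ◁ l ≗ M.T.map₂ l ▷ E.str ≫ eqToHom map_snd ≫ M.T.map π ◁ l :=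
    ((hl.whiskerLeft (M.m_naturality fst).symm).congr (.refl _) f.mul).unique hd
      (hl.iterate hp.w hπ map_snd _) (m_comp_map_comp_str snd)
  refine H.hom_ext ?_ ?_
  · rw [Strict.assoc, hπ, Strict.assoc, hπ, ← Strict.assoc (M.T.map π), ← M.T.map_comp, hπ,
      m_comp_map_comp_str]
  · rw [Strict.assoc, m_whiskerLeft.tgt, Strict.assoc]

theorem exists_pullback (f : A ⟶ B) (hp : p.IsStrict) (hd : IsDiscreteOpfibration p.hom)
    (H : IsLeftTightPullback fst snd f.hom p.hom) :
    ∃ (Q : Alg M) (q : Q ⟶ A) (r : Q ⟶ E),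
      IsLeftTightPullback q r f p ∧ IsLeftTightPullback q.hom r.hom f.hom p.hom := by
  obtain ⟨π, l, hπ, hl⟩ := exists_pullback_str hp hd H.toIsTwoPullback
  have π_tight : IsTight π := H.detects π (by
    rw [hπ]
    exact comp_tight (M.map_tight _ H.left_tight) A.str_tight)
  let Q : Alg M := ⟨P, π, π_tight, pullback_str_unit hd H.toIsTwoPullback hπ hl,
    pullback_str_assoc hp hd H.toIsTwoPullback hπ hl⟩
  let q : Q ⟶ A := LaxHom.ofStrict fst hπ.symm
  have hq : q.IsStrict := LaxHom.isStrict_ofStrict (A := Q) fst hπ.symm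
  have hl' : l ▷ p.hom ≗ (q ≫ f).laxator := hl.trans (comp_laxator_of_left hq f).symm
  exact ⟨Q, q, LaxHom.lift hp hd (q ≫ f) snd l hl', isLeftTightPullback_of_hom hq hp hd
    (LaxHom.lift_comp hp hd (q ≫ f) l hl' H.w.symm).symm H, H⟩

end PullbackAlgebra

theorem exists_isTightTerminal {t : K} (ht : IsTightTerminal t) :
    ∃ A : Alg M, IsTightTerminal A := by
  obtain ⟨τ, τ_tight, -⟩ := ht (M.T.obj t)
  let A : Alg M := ⟨t, τ, τ_tight, ht.hom_ext _ _, ht.hom_ext _ _⟩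
  refine ⟨A, fun X => ?_⟩
  obtain ⟨f, f_tight, -⟩ := ht X.carrier
  have hf : M.T.map f ≫ A.str = X.str ≫ f := ht.hom_ext _ _
  exact ⟨LaxHom.ofStrict f hf, ⟨LaxHom.isStrict_ofStrict (B := A) f hf, f_tight⟩,
    fun g => LaxHom.ext (ht.hom_ext _ _) (ht.twoCellEq _ _),
    fun η => LaxHom₂.ext (ht.twoCellEq _ _).eq⟩

theorem isPlumbus (hK : IsPlumbus K) : IsPlumbus (Alg M) where
  exists_terminal := by
    obtain ⟨t, ht⟩ := hK.exists_terminal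
    exact exists_isTightTerminal ht
  exists_pullback f p hp := by
    obtain ⟨hs, hp'⟩ := isTightDopf_iff.1 hp
    obtain ⟨P, fst, snd, H⟩ := hK.exists_pullback f.hom p.hom hp'
    obtain ⟨Q, q, r, HQ, -⟩ := exists_pullback f hs hp'.dopf H
    exact ⟨Q, q, r, HQ⟩
  detects_tight e p hp h := by
    obtain ⟨hs, hp'⟩ := isTightDopf_iff.1 hp
    exact ⟨LaxHom.isStrict_of_comp hs hp'.dopf h.1, hK.detects_tight _ _ hp' h.2⟩

theorem isTwoPullback_hom (hK : IsPlumbus K) {P A E B : Alg M} {fst : P ⟶ A} {snd : P ⟶ E}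
    {f : A ⟶ B} {p : E ⟶ B} (hp : IsTightDopf p) (H : IsTwoPullback fst snd f p) :
    IsTwoPullback fst.hom snd.hom f.hom p.hom := by
  obtain ⟨hs, hp'⟩ := isTightDopf_iff.1 hp
  obtain ⟨_, _, _, HP⟩ := hK.exists_pullback f.hom p.hom hp'
  obtain ⟨Q, q, r, HQ, HQ'⟩ := exists_pullback f hs hp'.dopf HP
  obtain ⟨j, k, hjk, hkj, rfl, rfl⟩ := H.exists_iso HQ.toIsTwoPullback
  exact HQ'.toIsTwoPullback.of_iso (congrArg LaxHom.hom hjk) (congrArg LaxHom.hom hkj)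

theorem isPullbackIdeal (hK : IsPlumbus K) {S : ∀ {E B : K}, (E ⟶ B) → Prop}
    (hS : IsPullbackIdeal S) : IsPullbackIdeal (K := Alg M) (Small S) where
  tightDopf _ hp := hp.1
  replete _ _ hp hp' h k hhk hkh hw := ⟨hp', hS.replete _ _ hp.2 (isTightDopf_iff.1 hp').2
    h.hom k.hom (congrArg LaxHom.hom hhk) (congrArg LaxHom.hom hkh) (congrArg LaxHom.hom hw)⟩
  pullback _ _ _ _ hp H := ⟨H.tightDopf hp.1, hS.pullback _ _ _ _ hp.2
    (hK.isLeftTightPullback (isTwoPullback_hom hK hp.1 H.toIsTwoPullback) (isTightDopf_iff.1 hp.1).2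
      H.left_tight.2)⟩

/-! ### Lifting the 2-classifier to algebras -/

section Classifier

variable {Apt A : Alg M}

/-- The strict morphism `U` of algebras has as underlying map a 2-classifier, its pullbacks are
preserved by the 2-monad, and it is `T`-cartesian: its cartesianity defect is invertible. These are
the data from which `U` is shown to be a 2-classifier of algebras. -/
structure IsCartesianClassifier (S : ∀ {E B : K}, (E ⟶ B) → Prop) (U : Apt ⟶ A) : Prop where
  isRepresentablePlumbus : IsRepresentablePlumbus S U.hom
  isStrict : U.IsStrict
  preservesPullbacks : M.PreservesPullbacks U.hom
  isTwoPullback : IsTwoPullback (M.T.map U.hom) Apt.str A.str U.hom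

namespace IsCartesianClassifier

variable {S : ∀ {E B : K}, (E ⟶ B) → Prop} {U : Apt ⟶ A}
  (hU : IsCartesianClassifier S U) {E B : Alg M} {p : E ⟶ B}
include hU

theorem isDiscreteOpfibration : IsDiscreteOpfibration U.hom :=
  hU.isRepresentablePlumbus.tightDopf.dopf

theorem isTightDopf : IsTightDopf U :=
  isTightDopf_iff.2 ⟨hU.isStrict, hU.isRepresentablePlumbus.tightDopf⟩

theorem isGeneric {P B : K} {p : P ⟶ B} {x : P ⟶ Apt.carrier} {d : B ⟶ A.carrier}
    (H : IsTwoPullback p x d U.hom) : IsGeneric p x d U.hom :=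
  hU.isRepresentablePlumbus.isTwoClassifier.isGeneric H

theorem map_isTwoPullback {P B : K} {p : P ⟶ B} {x : P ⟶ Apt.carrier} {d : B ⟶ A.carrier}
    (H : IsTwoPullback p x d U.hom) (hp : IsTight p) :
    IsTwoPullback (M.T.map p) (M.T.map x ≫ Apt.str) (M.T.map d ≫ A.str) U.hom :=
  hU.isRepresentablePlumbus.map_isTwoPullback hU.isTwoPullback hU.preservesPullbacks H hp

section LaxStructure

variable {x : E.carrier ⟶ Apt.carrier} {d : B.carrier ⟶ A.carrier} (hs : p.IsStrict)
  (hp : IsTight p.hom) (H : IsTwoPullback p.hom x d U.hom)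
include H

theorem laxator_unit {φ : M.T.map d ≫ A.str ⟶ B.str ≫ d}
    {l : M.T.map x ≫ Apt.str ⟶ E.str ≫ x} (hl : LiesOver (M.T.map p.hom) U.hom l φ) :
    M.i B.carrier ◁ φ ≗ 𝟙 d :=
  ((hU.isGeneric H).twoCell_ext (LiesOver.id H.w.symm)
    (hl.whiskerLeft (M.i_naturality p.hom).symm) (i_comp_map_comp_str d).symm
    (by rw [← Strict.assoc, B.unit, Strict.id_comp]) (i_comp_map_comp_str x).symm
    (by rw [← Strict.assoc, E.unit, Strict.id_comp])).symm

include hs hp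

theorem exists_laxator : ∃ (φ : M.T.map d ≫ A.str ⟶ B.str ≫ d)
    (l : M.T.map x ≫ Apt.str ⟶ E.str ≫ x), LiesOver (M.T.map p.hom) U.hom l φ := by
  have w : (E.str ≫ x) ≫ U.hom = M.T.map p.hom ≫ B.str ≫ d := by
    rw [Strict.assoc, ← H.w, ← Strict.assoc, ← hs.w, Strict.assoc]
  exact (hU.isGeneric (hU.map_isTwoPullback H hp) _ _ w).exists

theorem laxator_mul {φ : M.T.map d ≫ A.str ⟶ B.str ≫ d}
    {l : M.T.map x ≫ Apt.str ⟶ E.str ≫ x} (hl : LiesOver (M.T.map p.hom) U.hom l φ) :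
    M.m B.carrier ◁ φ ≗
      M.T.map₂ φ ▷ A.str ≫ eqToHom (lax_source_eq B A d) ≫ M.T.map B.str ◁ φ := by
  have hm := hl.whiskerLeft (M.m_naturality p.hom).symm
  have hT := hl.iterate hU.isTwoPullback.w hs.w.symm (lax_source_eq E Apt x) (lax_source_eq B A d)
  have H₂ := hU.map_isTwoPullback (hU.map_isTwoPullback H hp) (M.map_tight _ hp)
  exact ((hU.isGeneric H₂).twoCell_ext hT hm
    (m_comp_map_comp_str d).symm (by rw [← Strict.assoc (M.m _), B.assoc, Strict.assoc])
    (m_comp_map_comp_str x).symm (by rw [← Strict.assoc (M.m _), E.assoc, Strict.assoc])).symm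

theorem exists_lax_square :
    ∃ (D : B ⟶ A) (X : E ⟶ Apt), D.hom = d ∧ X.hom = x ∧ p ≫ D = X ≫ U := by
  obtain ⟨φ, l, hl⟩ := hU.exists_laxator hs hp H
  let D : B ⟶ A := LaxHom.mk d φ (hU.laxator_unit H hl) (hU.laxator_mul hs hp H hl)
  have hl' : l ▷ U.hom ≗ (p ≫ D).laxator := hl.trans (comp_laxator_of_left hs D).symm
  exact ⟨D, LaxHom.lift hU.isStrict hU.isDiscreteOpfibration (p ≫ D) x l hl', rfl, rfl,
    (LaxHom.lift_comp hU.isStrict hU.isDiscreteOpfibration (p ≫ D) l hl' H.w.symm).symm⟩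

theorem existsUnique_classifying :
    ∃! D : B ⟶ A, D.hom = d ∧ ∃ X : E ⟶ Apt, X.hom = x ∧ IsTwoPullback p X D U := by
  obtain ⟨D, X, rfl, rfl, w⟩ := hU.exists_lax_square hs hp H
  refine ⟨D, ⟨rfl, X, rfl, isTwoPullback_of_hom hs hU.isStrict hU.isDiscreteOpfibration w H⟩, ?_⟩
  rintro D' ⟨hD, X', hX, H'⟩
  refine LaxHom.ext hD ?_
  exact ((hU.isGeneric (hU.map_isTwoPullback H hp)).twoCell_ext
    (laxator_liesOver hs hU.isStrict w) (laxator_liesOver hs hU.isStrict H'.w)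
    (by rw [hD]) (by rw [hD]) (by rw [hX]) (by rw [hX])).symm

end LaxStructure

variable {X : E ⟶ Apt} {D : B ⟶ A}

theorem isTwoPullback_hom (H : IsTwoPullback p X D U) : IsTwoPullback p.hom X.hom D.hom U.hom :=
  Alg.isTwoPullback_hom hU.isRepresentablePlumbus.isPlumbus hU.isTightDopf H

theorem map₂_comp_laxator (H : IsTwoPullback p X D U) (hp : IsTight p) {G : B ⟶ A} {Z : E ⟶ Apt}
    (w : p ≫ G = Z ≫ U) {φ : D.hom ⟶ G.hom} {l : X.hom ⟶ Z.hom}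
    (hl : LiesOver p.hom U.hom l φ) :
    M.T.map₂ φ ▷ A.str ≫ G.laxator = D.laxator ≫ B.str ◁ φ := by
  have hl₁ := ((hl.map M.T).whiskerRight hU.isTwoPullback.w).comp
    (laxator_liesOver hp.1 hU.isStrict w)
  have hl₂ := (laxator_liesOver hp.1 hU.isStrict H.w).comp (hl.whiskerLeft hp.1.w.symm)
  exact ((hU.isGeneric (hU.map_isTwoPullback (hU.isTwoPullback_hom H) hp.2)).twoCell_ext
    hl₁ hl₂ rfl rfl rfl rfl).eq

theorem isGeneric_of_isTwoPullback (H : IsTwoPullback p X D U) (hp : IsTight p) :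
    IsGeneric p X D U := by
  intro G Z hZ
  obtain ⟨φ, ⟨l, hl⟩, hφ⟩ := hU.isGeneric (hU.isTwoPullback_hom H) G.hom Z.hom
    (congrArg LaxHom.hom hZ)
  let Φ : D ⟶ G := LaxHom₂.mk φ (hU.map₂_comp_laxator H hp hZ.symm hl)
  refine ⟨Φ, ⟨LaxHom₂.mk l ?_, twoCellEq_of_hom₂ H.w.symm hZ hl⟩, ?_⟩
  · exact (Alg.map₂_comp_laxator hU.isStrict hU.isDiscreteOpfibration H.w.symm (p ◁ Φ) hl
      ((comp_laxator_of_right Z hU.isStrict).symm.trans (laxator_congr hZ))).eq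
  · rintro Ψ ⟨m, hm⟩
    exact LaxHom₂.ext (hφ Ψ.hom₂ ⟨m.hom₂, hom₂_congr hm⟩)

theorem isRepresentablePlumbus_alg : IsRepresentablePlumbus (K := Alg M) (Small S) U := by
  have hK := hU.isRepresentablePlumbus
  have ideal := isPullbackIdeal (M := M) hK.isPlumbus hK.isPullbackIdeal
  refine ⟨isPlumbus hK.isPlumbus, ideal,
    fun t _ => ⟨IsTightDopf.id t, hK.small_identity t.carrier⟩,
    .of_isGeneric _ ideal ⟨hU.isTightDopf, hK.isTwoClassifier.small⟩
      (fun H => hU.isGeneric_of_isTwoPullback H.toIsTwoPullback H.left_tight) fun p hp => ?_⟩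
  obtain ⟨d, x, H⟩ := hK.exists_classifying p.hom hp.2
  obtain ⟨D, ⟨-, X, -, H'⟩, -⟩ := hU.existsUnique_classifying hp.1.tight.1 hp.1.tight.2 H
  exact ⟨D, X, H'⟩

theorem laxator_classifies_defect (H : IsTwoPullback p X D U) (hp : p.IsStrict) {P : K}
    {fst : P ⟶ M.T.obj B.carrier} {snd : P ⟶ E.carrier} {δ : M.T.obj E.carrier ⟶ P}
    (hδ : IsCartesianityDefect p fst snd δ) :
    IsTwoPullback fst (snd ≫ X.hom) (B.str ≫ D.hom) U.hom ∧
      Classifies U.hom (M.T.map p.hom) (M.T.map X.hom ≫ Apt.str) fst (snd ≫ X.hom) D.laxator δ := by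
  have hX : E.str ≫ X.hom = δ ≫ snd ≫ X.hom := by rw [← Strict.assoc, hδ.snd_eq]
  obtain ⟨l, hl⟩ := TwoCellEq.exists_of_eq rfl hX X.laxator
  exact ⟨hδ.isTwoPullback.paste (hU.isTwoPullback_hom H), hδ.fst_eq, l,
    (laxator_liesOver hp hU.isStrict H.w).congr hl (.refl _)⟩

end IsCartesianClassifier

end Classifier

end Alg

end Plumbus

/-- The lifting theorem. The second part describes the classifying maps of the small discrete
opfibrations `p : E ⟶ B` of algebras: every classifying map `d` of the underlying map of `p` carries
a unique lax structure making it a classifying map of `p`, and the laxator of a classifying map,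
as a 2-cell between classifying maps of `Tp` and of the pullback of `p` along the structure map
of `B`, classifies the `T`-cartesianity defect of `p`. -/
theorem mainTheorem1 {K : Type u} [Bicategory.{w, v} K] [Enhanced K]
    (Small : ∀ {E B : K}, (E ⟶ B) → Prop) {Ωpt Ω : K} (u : Ωpt ⟶ Ω)
    (hK : IsRepresentablePlumbus Small u) (M : EnhancedTwoMonad K)
    -- `Tu` is a small discrete opfibration
    (hTu : Small (M.T.map u))
    -- `T` preserves pullbacks of `u`
    (hT : ∀ {P B : K} (p : P ⟶ B) (x : P ⟶ Ωpt) (f : B ⟶ Ω), IsLeftTightPullback p x f u →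
      IsTwoPullback (M.T.map p) (M.T.map x) (M.T.map f) (M.T.map u))
    -- the unit and the multiplication are cartesian at `u`
    (hi : IsTwoPullback u (M.i Ωpt) (M.i Ω) (M.T.map u))
    (hm : IsTwoPullback (M.T.map (M.T.map u)) (M.m Ωpt) (M.m Ω) (M.T.map u))
    -- `ω` is a classifying map of `Tu`; it is tight, and a strict algebra structure
    (ω : M.T.obj Ω ⟶ Ω) (ωpt : M.T.obj Ωpt ⟶ Ωpt) (hω : IsTwoPullback (M.T.map u) ωpt ω u)
    (hω_tight : IsTight ω) (hω_unit : M.i Ω ≫ ω = 𝟙 Ω)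
    (hω_assoc : M.m Ω ≫ ω = M.T.map ω ≫ ω) :
    ∃ (ht : IsTight ωpt) (h₁ : M.i Ωpt ≫ ωpt = 𝟙 Ωpt)
      (h₂ : M.m Ωpt ≫ ωpt = M.T.map ωpt ≫ ωpt),
      let A : Alg M := ⟨Ω, ω, hω_tight, hω_unit, hω_assoc⟩
      let Apt : Alg M := ⟨Ωpt, ωpt, ht, h₁, h₂⟩
      let U : Apt ⟶ A := Alg.LaxHom.ofStrict u hω.w
      IsRepresentablePlumbus (K := Alg M) (Alg.Small Small) U ∧
      ∀ {E B : Alg M} (p : E ⟶ B), Alg.Small Small p →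
        (∀ (d : B.carrier ⟶ Ω) (x : E.carrier ⟶ Ωpt), IsTwoPullback p.hom x d u →
          ∃! D : B ⟶ A, D.hom = d ∧ ∃ X : E ⟶ Apt, X.hom = x ∧ IsTwoPullback p X D U) ∧
        (∀ (D : B ⟶ A) (X : E ⟶ Apt), IsTwoPullback p X D U →
          IsTwoPullback (M.T.map p.hom) (M.T.map X.hom ≫ ωpt) (M.T.map D.hom ≫ ω) u ∧
          ∀ {P : K} (fst : P ⟶ M.T.obj B.carrier) (snd : P ⟶ E.carrier)
            (δ : M.T.obj E.carrier ⟶ P), Alg.IsCartesianityDefect p fst snd δ →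
            IsTwoPullback fst (snd ≫ X.hom) (B.str ≫ D.hom) u ∧
            Classifies u (M.T.map p.hom) (M.T.map X.hom ≫ ωpt) fst (snd ≫ X.hom) D.laxator δ) := by
  refine ⟨hK.isTight_str hω hω_tight, hK.str_unit hω hω_unit, hK.str_assoc hω hT hω_assoc, ?_⟩
  intro A Apt U
  have hU : Alg.IsCartesianClassifier Small U :=
    ⟨hK, Alg.LaxHom.isStrict_ofStrict (A := Apt) (B := A) u hω.w, hT, hω⟩
  refine ⟨hU.isRepresentablePlumbus_alg, fun p hp => ⟨fun d x H => ?_, fun D X H => ⟨?_, ?_⟩⟩⟩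
  · exact hU.existsUnique_classifying hp.1.tight.1 hp.1.tight.2 H
  · exact hU.map_isTwoPullback (hU.isTwoPullback_hom H) hp.1.tight.2
  · exact fun fst snd δ hδ => hU.laxator_classifies_defect H hp.1.tight.1 hδ
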